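/- For an integer partition $\lambda$ of size $|\lambda|=n$, let $\lambda_1$ and $\lambda'_1$ be the lengths of the first row and of the first column of its Young diagram, and let $\mathrm{ST}(\lambda)$ be the set of standard tableaux of shape $\lambda$. A descent of $T\in\mathrm{ST}(\lambda)$ is an integer $i\in\{1,\dots,n-1\}$ such that $i+1$ lies in a row of larger index than the row of $i$ (rows being numbered by decreasing length, starting with the row of length $\lambda_1$), and $\mathrm{maj}(T)$ is the sum of the descents of $T$. For real random variables $U,V$, let $d_{\mathrm{Kol}}(U,V)=\sup_{s\in\mathbb{R}}\left|\mathbb{P}[U\le s]-\mathbb{P}[V\le s]\right|$. There is a universal constant $0<C\le 30$ with the following property. Let $(\lambda^{(n)})_{n\ge 1}$ be a sequence of integer partitions with $|\lambda^{(n)}|=n$ for all $n\ge 1$, and let $T^{(n)}$ be chosen uniformly at random in $\mathrm{ST}(\lambda^{(n)})$. Let $n_0\ge 4$ be an integer such that $$\max\left(\frac{\lambda^{(n)}_1}{n},\frac{\lambda^{(n)\prime}_1}{n}\right)\le\frac12\qquad\text{for all } n\ge n_0.$$ Then, for all $n\ge n_0$, $\mathrm{var}(\mathrm{maj}(T^{(n)}))>0$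 and $$d_{\mathrm{Kol}}\left(\frac{\mathrm{maj}(T^{(n)})-\mathbb{E}[\mathrm{maj}(T^{(n)})]}{\sqrt{\mathrm{var}(\mathrm{maj}(T^{(n)}))}},\,\mathcal{N}(0,1)\right)\le\frac{C}{\sqrt n}.$$ -/

import Mathlib

open MeasureTheory ProbabilityTheory

/-- A standard tableau of shape `μ`: a bijective numbering of the cells of `μ` by the integers
`1, …, |μ|` that is strictly increasing along the rows and along the columns. A cell is a pair
`(row, column)`, both counted from `0`. -/
structure StandardTableau (μ : YoungDiagram) where
  /-- the numbering of the cells -/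
  entry : {c : ℕ × ℕ // c ∈ μ.cells} ≃ {k : ℕ // k ∈ Finset.Icc 1 μ.card}
  /-- the entries increase strictly along each row -/
  row_strict : ∀ c d : {c : ℕ × ℕ // c ∈ μ.cells},
    c.1.1 = d.1.1 → c.1.2 < d.1.2 → (entry c).1 < (entry d).1
  /-- the entries increase strictly along each column -/
  col_strict : ∀ c d : {c : ℕ × ℕ // c ∈ μ.cells},
    c.1.2 = d.1.2 → c.1.1 < d.1.1 → (entry c).1 < (entry d).1

namespace StandardTableau

variable {μ : YoungDiagram}

theorem entry_injective :
    Function.Injective (StandardTableau.entry : StandardTableau μ → _) := by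
  rintro ⟨e, _, _⟩ ⟨f, _, _⟩ h
  cases h
  rfl

noncomputable instance : Fintype (StandardTableau μ) :=
  Fintype.ofInjective _ entry_injective

/-- Every set of tableaux is an event. -/
instance : MeasurableSpace (StandardTableau μ) := ⊤

/-- The descents of a standard tableau of size `n`: the integers `i` in `{1, …, n - 1}` such that
the row of `i + 1` has a larger index than the row of `i` (in the convention where the first row is
drawn at the bottom, `i + 1` is in a row strictly above the row of `i`). -/
def descents (T : StandardTableau μ) : Finset ℕ :=
  (Finset.Ico 1 μ.card).filter fun i =>
    ∃ c d : {c : ℕ × ℕ // c ∈ μ.cells},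
      (T.entry c).1 = i ∧ (T.entry d).1 = i + 1 ∧ c.1.1 < d.1.1

/-- The major index: the sum of the descents. -/
def maj (T : StandardTableau μ) : ℕ := ∑ i ∈ T.descents, i

end StandardTableau

/-- The uniform law on the finite set of standard tableaux of shape `μ`. -/
noncomputable def uniformTableau (μ : YoungDiagram) : Measure (StandardTableau μ) :=
  uniformOn Set.univ

/-- The expectation of the major index of a uniform random standard tableau of shape `μ`. -/
noncomputable def majMean (μ : YoungDiagram) : ℝ :=
  ∫ T, (T.maj : ℝ) ∂(uniformTableau μ)

/-- The variance of the major index of a uniform random standard tableau of shape `μ`. -/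
noncomputable def majVar (μ : YoungDiagram) : ℝ :=
  variance (fun T : StandardTableau μ => (T.maj : ℝ)) (uniformTableau μ)

/-- The law of the standardized major index `(maj T - E[maj T]) / √(var (maj T))`, where `T` is a
uniform random standard tableau of shape `μ`. -/
noncomputable def standardizedMajLaw (μ : YoungDiagram) : Measure ℝ :=
  (uniformTableau μ).map fun T => ((T.maj : ℝ) - majMean μ) / √(majVar μ)

/-- The Kolmogorov distance between two probability measures on `ℝ`: the supremum distance between
their distribution functions. -/
noncomputable def kolmogorovDist (P Q : Measure ℝ) : ℝ :=
  ⨆ s : ℝ, |P.real (Set.Iic s) - Q.real (Set.Iic s)|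

/-- A growing sequence of integer partitions: the `n`-th one has size `n`, for every `n ≥ 1`. -/
def IsGrowing (lam : ℕ → YoungDiagram) : Prop :=
  ∀ n : ℕ, 1 ≤ n → (lam n).card = n

/-!
The major index of a uniform random standard tableau `T` of shape `μ`, with `|μ| = n`, has an
explicit characteristic function, from which the bound follows by Esseen's smoothing inequality.

*The `q`-hook length formula.* Up to powers of `q`, the generating function `∑ q ^ maj T` is
`∏ [k]_q / ∏ [h c]_q`, with `k` in `{1, …, n}` and `h c` the hook lengths
(`StandardTableau.exists_sum_pow_maj_mul_hook`). Write `M μ` for the principal specialization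
`s_μ(1, q, q ^ 2, …)`, given as a ratio of alternants (`shapeWeight`). Multilinearity of the
determinant and a telescoping sum in each row give the branching rule `M lam = ∑ q ^ |μ| M μ`, over
the `μ` for which `lam / μ` is a horizontal strip (`alternantWeight_sum_strips`). On the side of
tableaux, removing the largest entry gives a recursion on the tableaux whose largest entry lies in a
given row `r`, in which the descent at `n - 1` only depends on `r` and on the row of the new largest
entry. The sum over the strips whose first nonempty row is `r` satisfies the same recursion
(`StandardTableau.sum_rowOf_eq_stripSum`). Comparing the parts `{h (i, j)}` and `{l i - l k}` of
`{1, …, l i}` turns alternants into hook products (`YoungDiagram.prod_hookLen_row`).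

*The characteristic function.* On the unit circle the formula says that, after centering,
`E exp (i t maj) = ∏ sinc (k t / 2) / ∏ sinc (h c t / 2)`. At most `n + 1 - m` cells have hook
length at least `m` (`YoungDiagram.card_le_hookLen`), so that `∑ f (h c) ≤ ∑ f k` for all increasing
`f` vanishing at `0`. With `f x = -log (sinc x) - x ^ 2 / 6`, which is increasing and `O (x ^ 4)`,
this gives, for `0 < t ≤ 3 / n`,
`E exp (i t (maj - E maj)) = exp (-v t ^ 2 / 2 - G t)` with `0 ≤ G t ≤ n ^ 5 t ^ 4 / 288`,
where `v = (∑ k ^ 2 - ∑ (h c) ^ 2) / 12` is the variance. If the first row and the first column have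
length at most `n / 2`, no hook has length `n`, so that `v > 0`; and `∑ (h c) ^ 2` is at most
`n ^ 3 / 6` up to a quadratic error, so that `v ≥ n ^ 3 / 80` for `n ≥ 900`.

*Smoothing.* For `n < 900` the bound `30 / √n` exceeds `1`. For `n ≥ 900` the smoothing inequality
(`abs_measureReal_Iic_sub_le`, proved with the Fejér kernel) is applied on the frequencies up to
`T = 3 √v / n`, which is of order `√n`.
-/

/-! ### Principal specializations and horizontal strips -/

/-- The `q`-Pochhammer symbol `(q; q)_m = (1 - q) (1 - q ^ 2) ⋯ (1 - q ^ m)`. -/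
def qPoch {K : Type*} [Field K] (q : K) (m : ℕ) : K := ∏ k ∈ Finset.range m, (1 - q ^ (k + 1))

section QAlgebra

variable {K : Type*} [Field K] {q : K}

theorem qPoch_succ (q : K) (m : ℕ) : qPoch q (m + 1) = qPoch q m * (1 - q ^ (m + 1)) :=
  Finset.prod_range_succ _ _

theorem qPoch_ne_zero (hq : ∀ k, 1 ≤ k → q ^ k ≠ 1) (m : ℕ) : qPoch q m ≠ 0 :=
  Finset.prod_ne_zero_iff.2 fun k _ => sub_ne_zero.2 (hq (k + 1) (by omega)).symm

/-- The polynomial `x ^ j - (1 - q ^ j) x ^ (j - 1)`, which is `1` for `j = 0`. -/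
noncomputable def stripPoly (q : K) : ℕ → Polynomial K
  | 0 => 1
  | j + 1 => Polynomial.X ^ (j + 1) - Polynomial.C (1 - q ^ (j + 1)) * Polynomial.X ^ j

theorem stripPoly_monic_natDegree (q : K) (j : ℕ) :
    (stripPoly q j).Monic ∧ (stripPoly q j).natDegree = j := by
  cases j with
  | zero => simp [stripPoly]
  | succ j =>
    have hd : (Polynomial.C (1 - q ^ (j + 1)) * Polynomial.X ^ j).degree <
        ((j + 1 : ℕ) : WithBot ℕ) :=
      (Polynomial.degree_C_mul_X_pow_le _ _).trans_lt (by exact_mod_cast Nat.lt_succ_self j)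
    refine ⟨Polynomial.monic_X_pow_sub hd, ?_⟩
    simp only [stripPoly]
    rw [Polynomial.natDegree_sub_eq_left_of_natDegree_lt]
    · simp
    · rw [Polynomial.natDegree_X_pow]
      exact (Polynomial.natDegree_C_mul_X_pow_le _ _).trans_lt (Nat.lt_succ_self j)

/-- A discrete antiderivative in `a` of `q ^ a * stripPoly q j (q ^ a) / (q; q)_a`. -/
def stripPrim (q : K) (j a : ℕ) : K := q ^ (j * a) * (1 - q ^ a) / qPoch q a

theorem stripPrim_zero (q : K) (j : ℕ) : stripPrim q j 0 = 0 := by simp [stripPrim]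

theorem stripPrim_succ (hq : ∀ k, 1 ≤ k → q ^ k ≠ 1) (j m : ℕ) :
    stripPrim q j (m + 1) = (qPoch q m)⁻¹ * (q ^ j * (q ^ m) ^ j) := by
  have h1 := qPoch_ne_zero hq m
  have h2 : 1 - q ^ (m + 1) ≠ 0 := sub_ne_zero.2 (hq (m + 1) (by omega)).symm
  rw [stripPrim, qPoch_succ, mul_comm j, pow_mul, pow_succ, mul_pow] at *
  field_simp

theorem stripPrim_sub (hq : ∀ k, 1 ≤ k → q ^ k ≠ 1) (j m : ℕ) :
    stripPrim q j (m + 1) - stripPrim q j m =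
      q ^ m * (qPoch q m)⁻¹ * (stripPoly q j).eval (q ^ m) := by
  have h1 := qPoch_ne_zero hq m
  rw [stripPrim_succ hq, stripPrim]
  cases j with
  | zero => simp [stripPoly]; field_simp; ring
  | succ j =>
    simp only [stripPoly, Polynomial.eval_sub, Polynomial.eval_mul, Polynomial.eval_pow,
      Polynomial.eval_X, Polynomial.eval_C]
    rw [mul_comm (j + 1) m, pow_mul q m]
    field_simp
    ring

/-- Up to a normalization, the principal specialization at `1, q, q ^ 2, …` of the Schur function
of the partition with rows `μ 0, …, μ (N - 1)`, as a ratio of alternants. -/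
noncomputable def alternantWeight (q : K) {N : ℕ} (μ : Fin N → ℕ) : K :=
  (∏ i : Fin N, (qPoch q (μ i + (N - 1 - i)))⁻¹) *
    (Matrix.vandermonde fun i : Fin N => q ^ (μ i + (N - 1 - i))).det

theorem prod_pow_rev (q : K) (N : ℕ) :
    ∏ i : Fin N, q ^ (N - 1 - (i : ℕ)) = ∏ j : Fin N, q ^ (j : ℕ) := by
  rw [← Equiv.prod_comp Fin.revPerm (fun j : Fin N => q ^ (j : ℕ))]
  refine Finset.prod_congr rfl fun i _ => ?_
  congr 1
  simp [Fin.val_rev]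
  omega

/-- The difference of consecutive rows, the row after the last one being zero, leaves the
determinant unchanged. -/
theorem det_sub_next_row {N : ℕ} (e : ℕ → Fin N → K) (he : ∀ j, e N j = 0) :
    (Matrix.of fun i j : Fin N => e i j - e (i + 1) j).det =
      (Matrix.of fun i j : Fin N => e i j).det := by
  cases N with
  | zero => simp
  | succ n =>
    rw [← Matrix.det_submatrix_equiv_self Fin.revPerm (Matrix.of fun i j : Fin (n+1) => e i j),
      ← Matrix.det_submatrix_equiv_self Fin.revPerm
        (Matrix.of fun i j : Fin (n+1) => e i j - e (i + 1) j)]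
    symm
    refine Matrix.det_eq_of_forall_row_eq_smul_add_pred (fun _ => 1) ?_ ?_
    · intro j
      simp [he]
    · intro i j
      have : ((Fin.rev i.succ : Fin (n+1)) : ℕ) + 1 = (Fin.rev i.castSucc : Fin (n+1)) := by
        simp [Fin.val_rev]; omega
      simp only [Matrix.submatrix_apply, Matrix.of_apply, Fin.revPerm_apply, this]
      ring

/-- Branching rule: summing over all `μ` interlacing with `lam`, that is over all ways of removing a
horizontal strip. The determinant is multilinear in its rows, and the sum in each row telescopes
with the primitive `stripPrim`. -/
theorem alternantWeight_sum_strips (hq0 : q ≠ 0) (hq : ∀ k, 1 ≤ k → q ^ k ≠ 1) {N : ℕ} {lam : ℕ → ℕ}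
    (hlam : Antitone lam) (hN : lam N = 0) :
    ∑ μ ∈ Fintype.piFinset (fun i : Fin N => Finset.Icc (lam (i + 1)) (lam i)),
      (∏ i, q ^ μ i) * alternantWeight q μ = alternantWeight q fun i : Fin N => lam i := by
  have hterm : ∀ μ : Fin N → ℕ, (∏ i, q ^ μ i) * alternantWeight q μ =
      (Matrix.of fun i j : Fin N => q ^ μ i * (qPoch q (μ i + (N - 1 - i)))⁻¹ *
        (stripPoly q j).eval (q ^ (μ i + (N - 1 - i)))).det := by
    intro μ
    rw [alternantWeight, Matrix.det_eval_matrixOfPolynomials_eq_det_vandermonde _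
      (fun j : Fin N => stripPoly q j) (fun j => (stripPoly_monic_natDegree q j).2)
      (fun j => (stripPoly_monic_natDegree q j).1), ← mul_assoc, ← Finset.prod_mul_distrib,
      ← Matrix.det_mul_column]
    rfl
  simp_rw [hterm]
  have hsum := (Matrix.detRowAlternating (R := K) (n := Fin N)).toMultilinearMap.map_sum_finset
    (fun (i : Fin N) (m : ℕ) (j : Fin N) => q ^ m * (qPoch q (m + (N - 1 - i)))⁻¹ *
        (stripPoly q j).eval (q ^ (m + (N - 1 - i)))) (fun i : Fin N => Finset.Icc (lam (i + 1)) (lam i))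
  refine hsum.symm.trans ?_
  have hrow : (fun i : Fin N => ∑ m ∈ Finset.Icc (lam (i + 1)) (lam i), fun j : Fin N =>
      q ^ m * (qPoch q (m + (N - 1 - i)))⁻¹ * (stripPoly q j).eval (q ^ (m + (N - 1 - i)))) =
      Matrix.of fun i j : Fin N => (q ^ (N - 1 - (i : ℕ)))⁻¹ *
        (Matrix.of fun i j : Fin N => stripPrim q j (lam i + (N - i)) -
          stripPrim q j (lam (i + 1) + (N - (i + 1)))) i j := by
    funext i j
    rw [Finset.sum_apply]
    have hi := i.2
    have key : ∀ m, q ^ m * (qPoch q (m + (N - 1 - i)))⁻¹ *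
        (stripPoly q j).eval (q ^ (m + (N - 1 - i))) = (q ^ (N - 1 - (i : ℕ)))⁻¹ *
          (stripPrim q j ((m + 1) + (N - 1 - i)) - stripPrim q j (m + (N - 1 - i))) := by
      intro m
      rw [show m + 1 + (N - 1 - (i : ℕ)) = m + (N - 1 - i) + 1 by ring, stripPrim_sub hq, pow_add]
      have := pow_ne_zero (N - 1 - (i : ℕ)) hq0
      field_simp
    simp_rw [key]
    have hle : lam (i + 1) ≤ lam i + 1 := (hlam (Nat.le_succ _)).trans (Nat.le_succ _)
    rw [← Finset.mul_sum, ← Finset.Ico_add_one_right_eq_Icc,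
      Finset.sum_Ico_sub (fun m => stripPrim q j (m + (N - 1 - (i : ℕ)))) hle,
      show lam i + 1 + (N - 1 - (i : ℕ)) = lam i + (N - i) by omega,
      show lam (i + 1) + (N - 1 - (i : ℕ)) = lam (i + 1) + (N - (i + 1)) by omega]
    rfl
  have hdet : ∀ A : Matrix (Fin N) (Fin N) K,
    (Matrix.detRowAlternating (R := K) (n := Fin N)).toMultilinearMap A = A.det := fun _ => rfl
  rw [hrow, hdet, Matrix.det_mul_column,
    det_sub_next_row (fun i j => stripPrim q j (lam i + (N - i))) (by simp [hN, stripPrim_zero])]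
  have hprim : (Matrix.of fun i j : Fin N => stripPrim q j (lam i + (N - i))) =
      Matrix.of fun i j : Fin N => (qPoch q (lam i + (N - 1 - i)))⁻¹ *
        (Matrix.of fun i j : Fin N => q ^ (j : ℕ) *
          (Matrix.vandermonde fun i : Fin N => q ^ (lam i + (N - 1 - i))) i j) i j := by
    ext i j
    have hi := i.2
    simp only [Matrix.of_apply, Matrix.vandermonde_apply]
    rw [← stripPrim_succ hq]
    congr 1
    omega
  rw [hprim, Matrix.det_mul_column, Matrix.det_mul_row, alternantWeight, Finset.prod_inv_distrib,
    prod_pow_rev]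
  have : ∏ j : Fin N, q ^ (j : ℕ) ≠ 0 := Finset.prod_ne_zero_iff.2 fun j _ => pow_ne_zero _ hq0
  field_simp

theorem alternantWeight_zero_ne_zero (hq0 : q ≠ 0) (hq : ∀ k, 1 ≤ k → q ^ k ≠ 1) (N : ℕ) :
    alternantWeight q (0 : Fin N → ℕ) ≠ 0 := by
  refine mul_ne_zero (Finset.prod_ne_zero_iff.2 fun i _ => inv_ne_zero (qPoch_ne_zero hq _)) ?_
  refine Matrix.det_vandermonde_ne_zero_iff.2 fun i j hij => ?_
  have key : ∀ a b : ℕ, a ≤ b → q ^ a = q ^ b → a = b := by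
    intro a b hab h
    by_contra hne
    apply hq (b - a) (by omega)
    have h2 := pow_ne_zero a hq0
    rw [← Nat.add_sub_cancel' hab, pow_add] at h
    exact (mul_eq_left₀ h2).1 h.symm
  have h1 : N - 1 - (i : ℕ) = N - 1 - j := by
    have hij' : q ^ (N - 1 - (i : ℕ)) = q ^ (N - 1 - (j : ℕ)) := by simpa using hij
    rcases le_total (N - 1 - (i : ℕ)) (N - 1 - j) with h | h
    · exact key _ _ h hij'
    · exact (key _ _ h hij'.symm).symm
  have hi := i.2
  have hj := j.2
  exact Fin.ext (by omega)

/-- The principal specialization at `1, q, q ^ 2, …` of the Schur function of the partition with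
rows `lam 0, …, lam (N - 1)`, normalized to be `1` at the empty partition. -/
noncomputable def shapeWeight (q : K) (N : ℕ) (lam : ℕ → ℕ) : K :=
  alternantWeight q (fun i : Fin N => lam i) / alternantWeight q (0 : Fin N → ℕ)

/-- The sum of `q ^ |μ| * shapeWeight q N μ` over the partitions `μ` for which `lam / μ` is a
horizontal strip that avoids the first `r` rows. -/
noncomputable def stripSum (q : K) (N : ℕ) (lam : ℕ → ℕ) (r : ℕ) : K :=
  ∑ μ ∈ Fintype.piFinset
      (fun i : Fin N => if (i : ℕ) < r then {lam i} else Finset.Icc (lam (i + 1)) (lam i)),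
    (∏ i, q ^ μ i) * (alternantWeight q μ / alternantWeight q (0 : Fin N → ℕ))

theorem stripSum_zero (hq0 : q ≠ 0) (hq : ∀ k, 1 ≤ k → q ^ k ≠ 1) {N : ℕ} {lam : ℕ → ℕ}
    (hlam : Antitone lam) (hN : lam N = 0) : stripSum q N lam 0 = shapeWeight q N lam := by
  rw [shapeWeight, ← alternantWeight_sum_strips hq0 hq hlam hN, Finset.sum_div]
  simp [stripSum, mul_div_assoc]

theorem stripSum_self (q : K) (N : ℕ) (lam : ℕ → ℕ) :
    stripSum q N lam N = q ^ (∑ i : Fin N, lam i) * shapeWeight q N lam := by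
  have : Fintype.piFinset (fun i : Fin N =>
      if (i : ℕ) < N then {lam i} else Finset.Icc (lam (i + 1)) (lam i)) =
      {fun i : Fin N => lam i} := by
    ext μ
    simp [funext_iff]
  rw [stripSum, this, Finset.sum_singleton, Finset.prod_pow_eq_pow_sum, shapeWeight]

/-- The difference of consecutive strip sums collects the strips whose first nonempty row is `r`.
One cell of row `r` is always removed there, which leaves a free strip in the diminished shape. -/
theorem stripSum_sub (q : K) {N r : ℕ} {lam : ℕ → ℕ} (hlam : Antitone lam) (hr : r < N) :
    stripSum q N lam r - stripSum q N lam (r + 1) =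
      if lam (r + 1) < lam r then stripSum q N (Function.update lam r (lam r - 1)) r else 0 := by
  set A := fun (l : ℕ → ℕ) (s : ℕ) => Fintype.piFinset
      (fun i : Fin N => if (i : ℕ) < s then {l i} else Finset.Icc (l (i + 1)) (l i)) with hA
  have hle : lam (r + 1) ≤ lam r := hlam (Nat.le_succ r)
  have hmem : ∀ (μ : Fin N → ℕ), μ ∈ A lam (r + 1) ↔ μ ∈ A lam r ∧ μ ⟨r, hr⟩ = lam r := by
    intro μ
    simp only [hA, Fintype.mem_piFinset]
    constructor
    · intro h
      have h0 : μ ⟨r, hr⟩ = lam r := by simpa using h ⟨r, hr⟩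
      refine ⟨fun i => ?_, h0⟩
      rcases lt_trichotomy (i : ℕ) r with hi | hi | hi
      · simpa [hi, hi.trans (Nat.lt_succ_self r)] using h i
      · obtain rfl : i = ⟨r, hr⟩ := Fin.ext hi
        simp only [lt_irrefl, if_false, Finset.mem_Icc, h0]
        exact ⟨hle, le_rfl⟩
      · have := h i
        rw [if_neg (by omega)] at this ⊢
        exact this
    · rintro ⟨h, h0⟩ i
      rcases lt_trichotomy (i : ℕ) r with hi | hi | hi
      · simpa [hi, hi.trans (Nat.lt_succ_self r)] using h i
      · obtain rfl : i = ⟨r, hr⟩ := Fin.ext hi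
        simpa using h0
      · have := h i
        rw [if_neg (by omega)] at this ⊢
        exact this
  have hfilter : A lam (r + 1) = (A lam r).filter (fun μ => μ ⟨r, hr⟩ = lam r) := by
    ext μ
    rw [Finset.mem_filter, hmem]
  have hsub : stripSum q N lam r - stripSum q N lam (r + 1) =
      ∑ μ ∈ (A lam r).filter (fun μ => ¬ μ ⟨r, hr⟩ = lam r),
        (∏ i, q ^ μ i) * (alternantWeight q μ / alternantWeight q (0 : Fin N → ℕ)) := by
    rw [sub_eq_iff_eq_add', stripSum, stripSum]
    change ∑ μ ∈ A lam r, _ = ∑ μ ∈ A lam (r + 1), _ + _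
    rw [hfilter, Finset.sum_filter_add_sum_filter_not]
  rw [hsub]
  split_ifs with hc
  · rw [stripSum]
    refine Finset.sum_congr ?_ fun _ _ => rfl
    ext μ
    simp only [hA, Finset.mem_filter, Fintype.mem_piFinset]
    constructor
    · rintro ⟨h, h0⟩ i
      have hi' := h i
      rcases lt_trichotomy (i : ℕ) r with hi | hi | hi
      · simpa [hi, hi.ne] using hi'
      · obtain rfl : i = ⟨r, hr⟩ := Fin.ext hi
        simp only [lt_irrefl, if_false, Finset.mem_Icc, Function.update_self,
          Function.update_of_ne (show r + 1 ≠ r by omega)] at hi' ⊢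
        omega
      · rw [if_neg (by omega)] at hi' ⊢
        rwa [Function.update_of_ne (by omega), Function.update_of_ne (by omega)]
    · intro h
      refine ⟨fun i => ?_, ?_⟩
      · have hi' := h i
        rcases lt_trichotomy (i : ℕ) r with hi | hi | hi
        · simpa [hi, hi.ne] using hi'
        · obtain rfl : i = ⟨r, hr⟩ := Fin.ext hi
          simp only [lt_irrefl, if_false, Finset.mem_Icc, Function.update_self,
            Function.update_of_ne (show r + 1 ≠ r by omega)] at hi' ⊢
          omega
        · rw [if_neg (by omega)] at hi' ⊢
          rwa [Function.update_of_ne (by omega), Function.update_of_ne (by omega)] at hi'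
      · have hi' := h ⟨r, hr⟩
        simp only [lt_irrefl, if_false, Finset.mem_Icc, Function.update_self,
            Function.update_of_ne (show r + 1 ≠ r by omega)] at hi'
        omega
  · rw [Finset.filter_eq_empty_iff.2, Finset.sum_empty]
    intro μ hμ
    have := (Fintype.mem_piFinset.1 hμ) ⟨r, hr⟩
    simp only [lt_irrefl, if_false, Finset.mem_Icc] at this
    simp only [not_not]
    omega

theorem stripSum_zero_shape (hq0 : q ≠ 0) (hq : ∀ k, 1 ≤ k → q ^ k ≠ 1) (N r : ℕ) :
    stripSum q N 0 r = 1 := by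
  have : Fintype.piFinset (fun i : Fin N =>
      if (i : ℕ) < r then {(0 : ℕ → ℕ) i} else Finset.Icc ((0 : ℕ → ℕ) (i + 1)) ((0 : ℕ → ℕ) i)) =
      {0} := by
    ext μ
    simp [funext_iff]
  rw [stripSum, this, Finset.sum_singleton, div_self (alternantWeight_zero_ne_zero hq0 hq N)]
  simp

end QAlgebra

/-! ### Removing the largest entry of a standard tableau -/

namespace YoungDiagram

variable {μ : YoungDiagram}

/-- The diagram `μ` without the last cell of row `r`, when row `r + 1` is shorter than row `r`. -/
def eraseCorner (μ : YoungDiagram) (r : ℕ) (h : μ.rowLen (r + 1) < μ.rowLen r) : YoungDiagram where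
  cells := μ.cells.erase (r, μ.rowLen r - 1)
  isLowerSet := by
    intro a b hba ha
    rw [Finset.mem_coe, Finset.mem_erase] at ha ⊢
    refine ⟨?_, μ.isLowerSet hba ha.2⟩
    rintro rfl
    obtain ⟨i, j⟩ := a
    have ha2 := mem_iff_lt_rowLen.1 ((mem_cells _).1 ha.2)
    obtain ⟨h1, h2⟩ := Prod.mk_le_mk.1 hba
    rcases h1.eq_or_lt with rfl | h1
    · exact ha.1 (by rw [Prod.mk.injEq]; omega)
    · have := μ.rowLen_anti _ _ h1
      simp only [Nat.succ_eq_add_one] at this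
      omega

theorem corner_mem {r : ℕ} (h : μ.rowLen (r + 1) < μ.rowLen r) :
    (r, μ.rowLen r - 1) ∈ μ.cells :=
  (mem_cells _).2 (mem_iff_lt_rowLen.2 (by omega))

theorem card_eraseCorner {r : ℕ} (h : μ.rowLen (r + 1) < μ.rowLen r) :
    (μ.eraseCorner r h).card + 1 = μ.card :=
  Finset.card_erase_add_one (corner_mem h)

theorem mem_eraseCorner {r : ℕ} (h : μ.rowLen (r + 1) < μ.rowLen r) (c : ℕ × ℕ) :
    c ∈ (μ.eraseCorner r h).cells ↔ c ≠ (r, μ.rowLen r - 1) ∧ c ∈ μ.cells :=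
  Finset.mem_erase

theorem rowLen_eraseCorner {r : ℕ} (h : μ.rowLen (r + 1) < μ.rowLen r) :
    (μ.eraseCorner r h).rowLen = Function.update μ.rowLen r (μ.rowLen r - 1) := by
  funext i
  refine eq_of_forall_lt_iff fun j => ?_
  rw [← mem_iff_lt_rowLen, ← mem_cells, mem_eraseCorner, mem_cells, mem_iff_lt_rowLen, Ne,
    Prod.mk.injEq, Function.update_apply]
  split_ifs with hi
  · subst hi
    omega
  · simp [hi]

theorem cells_eq_biUnion_row {N : ℕ} (hN : μ.rowLen N = 0) :
    μ.cells = (Finset.range N).biUnion fun i => μ.row i := by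
  ext ⟨i, j⟩
  simp only [mem_cells, Finset.mem_biUnion, Finset.mem_range, mem_row_iff]
  refine ⟨fun h => ⟨i, ?_, h, rfl⟩, fun ⟨_, _, h, _⟩ => h⟩
  by_contra hi
  have h1 := μ.rowLen_anti N i (by omega)
  have h2 := mem_iff_lt_rowLen.1 h
  omega

theorem prod_cells {M : Type*} [CommMonoid M] {N : ℕ} (hN : μ.rowLen N = 0) (f : ℕ × ℕ → M) :
    ∏ c ∈ μ.cells, f c = ∏ i : Fin N, ∏ j ∈ Finset.range (μ.rowLen i), f (i, j) := by
  rw [cells_eq_biUnion_row hN, Finset.prod_biUnion,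
    Fin.prod_univ_eq_prod_range (fun i => ∏ j ∈ Finset.range (μ.rowLen i), f (i, j))]
  · exact Finset.prod_congr rfl fun i _ => by rw [row_eq_prod, Finset.prod_product]; simp
  · intro i _ j _ hij
    rw [Function.onFun, Finset.disjoint_left]
    intro c hc hc'
    exact hij ((mem_row_iff.1 hc).2.symm.trans (mem_row_iff.1 hc').2)

theorem sum_cells {M : Type*} [AddCommMonoid M] {N : ℕ} (hN : μ.rowLen N = 0) (f : ℕ × ℕ → M) :
    ∑ c ∈ μ.cells, f c = ∑ i : Fin N, ∑ j ∈ Finset.range (μ.rowLen i), f (i, j) :=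
  prod_cells (M := Multiplicative M) hN f

theorem card_eq_sum_rowLen {N : ℕ} (hN : μ.rowLen N = 0) :
    μ.card = ∑ i : Fin N, μ.rowLen i := by
  rw [YoungDiagram.card, Finset.card_eq_sum_ones, sum_cells hN]
  simp

end YoungDiagram

namespace StandardTableau

variable {μ : YoungDiagram}

/-- The row of the entry `k` of a tableau, with the value `0` if `k` is not an entry. -/
def rowOf (T : StandardTableau μ) (k : ℕ) : ℕ :=
  if h : k ∈ Finset.Icc 1 μ.card then (T.entry.symm ⟨k, h⟩).1.1 else 0

theorem rowOf_entry (T : StandardTableau μ) (c : {c : ℕ × ℕ // c ∈ μ.cells}) :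
    T.rowOf (T.entry c).1 = c.1.1 := by
  rw [rowOf, dif_pos (T.entry c).2]
  simp

theorem exists_entry_eq (T : StandardTableau μ) {k : ℕ} (hk : k ∈ Finset.Icc 1 μ.card) :
    ∃ c, (T.entry c).1 = k :=
  ⟨T.entry.symm ⟨k, hk⟩, by simp⟩

theorem maj_eq_sum (T : StandardTableau μ) :
    T.maj = ∑ i ∈ Finset.Ico 1 μ.card, if T.rowOf i < T.rowOf (i + 1) then i else 0 := by
  rw [maj, descents, Finset.sum_filter]
  refine Finset.sum_congr rfl fun i hi => ?_
  rw [Finset.mem_Ico] at hi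
  refine if_congr ⟨?_, fun h => ?_⟩ rfl rfl
  · rintro ⟨c, d, hc, hd, hcd⟩
    rwa [← hd, ← hc, rowOf_entry, rowOf_entry]
  · obtain ⟨c, hc⟩ := T.exists_entry_eq (k := i) (by rw [Finset.mem_Icc]; omega)
    obtain ⟨d, hd⟩ := T.exists_entry_eq (k := i + 1) (by rw [Finset.mem_Icc]; omega)
    refine ⟨c, d, hc, hd, ?_⟩
    rwa [← hd, ← hc, rowOf_entry, rowOf_entry] at h

theorem one_le_entry (T : StandardTableau μ) (c) : 1 ≤ (T.entry c).1 :=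
  (Finset.mem_Icc.1 (T.entry c).2).1

theorem entry_le (T : StandardTableau μ) (c) : (T.entry c).1 ≤ μ.card :=
  (Finset.mem_Icc.1 (T.entry c).2).2

/-- The largest entry of a tableau sits at the end of its row, and the next row is shorter. -/
theorem corner_of_entry_eq_card (T : StandardTableau μ) (c : {c : ℕ × ℕ // c ∈ μ.cells})
    (hc : (T.entry c).1 = μ.card) :
    μ.rowLen (c.1.1 + 1) < μ.rowLen c.1.1 ∧ c.1 = (c.1.1, μ.rowLen c.1.1 - 1) := by
  obtain ⟨⟨i, j⟩, hij⟩ := c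
  have hj := YoungDiagram.mem_iff_lt_rowLen.1 ((YoungDiagram.mem_cells _).1 hij)
  have h1 : j + 1 = μ.rowLen i := by
    by_contra hne
    have hmem : (i, j + 1) ∈ μ.cells :=
      (YoungDiagram.mem_cells _).2 (YoungDiagram.mem_iff_lt_rowLen.2 (by omega))
    have h := T.row_strict ⟨(i, j), hij⟩ ⟨(i, j + 1), hmem⟩ rfl (Nat.lt_succ_self j)
    have := T.entry_le ⟨(i, j + 1), hmem⟩
    omega
  have h2 : μ.rowLen (i + 1) ≤ j := by
    by_contra hlt
    have hmem : (i + 1, j) ∈ μ.cells :=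
      (YoungDiagram.mem_cells _).2 (YoungDiagram.mem_iff_lt_rowLen.2 (by omega))
    have h := T.col_strict ⟨(i, j), hij⟩ ⟨(i + 1, j), hmem⟩ rfl (Nat.lt_succ_self i)
    have := T.entry_le ⟨(i + 1, j), hmem⟩
    omega
  refine ⟨by dsimp only; omega, ?_⟩
  rw [Prod.mk.injEq]
  dsimp only
  omega

theorem natCard_cells_eq_natCard_Icc (μ : YoungDiagram) :
    Nat.card {c : ℕ × ℕ // c ∈ μ.cells} = Nat.card {k : ℕ // k ∈ Finset.Icc 1 μ.card} := by
  have h := Nat.card_eq_finsetCard (Finset.Icc 1 μ.card)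
  rw [Nat.card_Icc, Nat.add_sub_cancel] at h
  exact (Nat.card_eq_finsetCard μ.cells).trans h.symm

/-- A tableau from an injective numbering of the cells. -/
noncomputable def ofInjective (e : {c : ℕ × ℕ // c ∈ μ.cells} → {k : ℕ // k ∈ Finset.Icc 1 μ.card})
    (he : Function.Injective e)
    (hrow : ∀ c d, c.1.1 = d.1.1 → c.1.2 < d.1.2 → (e c).1 < (e d).1)
    (hcol : ∀ c d, c.1.2 = d.1.2 → c.1.1 < d.1.1 → (e c).1 < (e d).1) : StandardTableau μ where
  entry := Equiv.ofBijective e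
    (Function.Injective.bijective_of_nat_card_le he (natCard_cells_eq_natCard_Icc μ).ge)
  row_strict := hrow
  col_strict := hcol

section Corner

variable {r : ℕ} (h : μ.rowLen (r + 1) < μ.rowLen r)

theorem rowOf_card_eq_iff (T : StandardTableau μ) :
    T.rowOf μ.card = r ↔ (T.entry ⟨_, YoungDiagram.corner_mem h⟩).1 = μ.card := by
  constructor
  · intro hr
    have hpos : 1 ≤ μ.card := by
      have := YoungDiagram.card_eraseCorner h
      omega
    obtain ⟨c, hc⟩ := T.exists_entry_eq (k := μ.card) (by rw [Finset.mem_Icc]; omega)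
    rw [← hc, rowOf_entry] at hr
    have h2 := (T.corner_of_entry_eq_card c hc).2
    rw [hr] at h2
    have h3 : c = ⟨_, YoungDiagram.corner_mem h⟩ := Subtype.ext h2
    exact h3 ▸ hc
  · intro hr
    conv_lhs => rw [← hr]
    rw [rowOf_entry]

/-- Remove the largest entry of a tableau, when it lies in row `r`. -/
noncomputable def removeMax (T : StandardTableau μ) (hT : T.rowOf μ.card = r) :
    StandardTableau (μ.eraseCorner r h) :=
  ofInjective
    (fun x => ⟨(T.entry ⟨x.1, ((YoungDiagram.mem_eraseCorner h _).1 x.2).2⟩).1, by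
      have h1 := T.one_le_entry ⟨x.1, ((YoungDiagram.mem_eraseCorner h _).1 x.2).2⟩
      have h2 := T.entry_le ⟨x.1, ((YoungDiagram.mem_eraseCorner h _).1 x.2).2⟩
      have h3 : (T.entry ⟨x.1, ((YoungDiagram.mem_eraseCorner h _).1 x.2).2⟩).1 ≠ μ.card := by
        intro h4
        have h5 := T.entry.injective (Subtype.ext (h4.trans ((rowOf_card_eq_iff h T).1 hT).symm))
        exact ((YoungDiagram.mem_eraseCorner h _).1 x.2).1 (congrArg Subtype.val h5)
      have h4 := YoungDiagram.card_eraseCorner h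
      rw [Finset.mem_Icc]
      omega⟩)
    (fun x y hxy => by
      have h1 := T.entry.injective (Subtype.ext (Subtype.mk.inj hxy))
      exact Subtype.ext (Subtype.mk.inj h1))
    (fun c d h1 h2 => T.row_strict _ _ h1 h2)
    (fun c d h1 h2 => T.col_strict _ _ h1 h2)

theorem removeMax_entry (T : StandardTableau μ) (hT : T.rowOf μ.card = r) (x) :
    ((T.removeMax h hT).entry x).1 =
      (T.entry ⟨x.1, ((YoungDiagram.mem_eraseCorner h _).1 x.2).2⟩).1 := rfl

/-- Put a new largest entry at the end of row `r`. -/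
noncomputable def addMax (T : StandardTableau (μ.eraseCorner r h)) : StandardTableau μ :=
  ofInjective
    (fun x => if hx : x.1 = (r, μ.rowLen r - 1) then
        ⟨μ.card, by have := YoungDiagram.card_eraseCorner h; rw [Finset.mem_Icc]; omega⟩
      else
        ⟨(T.entry ⟨x.1, (YoungDiagram.mem_eraseCorner h _).2 ⟨hx, x.2⟩⟩).1, by
          have h1 := T.one_le_entry ⟨x.1, (YoungDiagram.mem_eraseCorner h _).2 ⟨hx, x.2⟩⟩
          have h2 := T.entry_le ⟨x.1, (YoungDiagram.mem_eraseCorner h _).2 ⟨hx, x.2⟩⟩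
          have := YoungDiagram.card_eraseCorner h
          rw [Finset.mem_Icc]
          omega⟩)
    (fun x y hxy => by
      have hcard := YoungDiagram.card_eraseCorner h
      have hxy' := congrArg Subtype.val hxy
      dsimp only at hxy'
      split_ifs at hxy' with hx hy hy
      · exact Subtype.ext (hx.trans hy.symm)
      · have := T.entry_le ⟨y.1, (YoungDiagram.mem_eraseCorner h _).2 ⟨hy, y.2⟩⟩
        have hxy'' : μ.card = (T.entry ⟨y.1, (YoungDiagram.mem_eraseCorner h _).2 ⟨hy, y.2⟩⟩).1 :=
          hxy'
        omega
      · have := T.entry_le ⟨x.1, (YoungDiagram.mem_eraseCorner h _).2 ⟨hx, x.2⟩⟩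
        have hxy'' : (T.entry ⟨x.1, (YoungDiagram.mem_eraseCorner h _).2 ⟨hx, x.2⟩⟩).1 = μ.card :=
          hxy'
        omega
      · have h1 := T.entry.injective (Subtype.ext hxy')
        exact Subtype.ext (Subtype.mk.inj h1))
    (fun c d h1 h2 => by
      have hcard := YoungDiagram.card_eraseCorner h
      split_ifs with hc hd hd
      · rw [hc, hd] at h2
        exact absurd h2 (lt_irrefl _)
      · have hd' := YoungDiagram.mem_iff_lt_rowLen.1 ((YoungDiagram.mem_cells (d.1.1, d.1.2)).1 d.2)
        have hc1 : c.1.1 = r := congrArg Prod.fst hc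
        have hc2 : c.1.2 = μ.rowLen r - 1 := congrArg Prod.snd hc
        rw [← h1, hc1] at hd'
        omega
      · have := T.entry_le ⟨c.1, (YoungDiagram.mem_eraseCorner h _).2 ⟨hc, c.2⟩⟩
        change (T.entry _).1 < μ.card
        omega
      · exact T.row_strict _ _ h1 h2)
    (fun c d h1 h2 => by
      have hcard := YoungDiagram.card_eraseCorner h
      split_ifs with hc hd hd
      · rw [hc, hd] at h2
        exact absurd h2 (lt_irrefl _)
      · have hd' := YoungDiagram.mem_iff_lt_rowLen.1 ((YoungDiagram.mem_cells (d.1.1, d.1.2)).1 d.2)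
        have hc1 : c.1.1 = r := congrArg Prod.fst hc
        have hc2 : c.1.2 = μ.rowLen r - 1 := congrArg Prod.snd hc
        have := μ.rowLen_anti (r + 1) d.1.1 (by omega)
        omega
      · have := T.entry_le ⟨c.1, (YoungDiagram.mem_eraseCorner h _).2 ⟨hc, c.2⟩⟩
        change (T.entry _).1 < μ.card
        omega
      · exact T.col_strict _ _ h1 h2)

theorem addMax_entry_corner (T : StandardTableau (μ.eraseCorner r h)) :
    ((T.addMax h).entry ⟨_, YoungDiagram.corner_mem h⟩).1 = μ.card := by
  change (dite _ _ _ : {k : ℕ // k ∈ Finset.Icc 1 μ.card}).1 = _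
  rw [dif_pos rfl]

theorem addMax_entry_of_ne (T : StandardTableau (μ.eraseCorner r h))
    (x : {c : ℕ × ℕ // c ∈ μ.cells}) (hx : x.1 ≠ (r, μ.rowLen r - 1)) :
    ((T.addMax h).entry x).1 =
      (T.entry ⟨x.1, (YoungDiagram.mem_eraseCorner h _).2 ⟨hx, x.2⟩⟩).1 := by
  change (dite _ _ _ : {k : ℕ // k ∈ Finset.Icc 1 μ.card}).1 = _
  rw [dif_neg hx]

theorem ext_entry {T T' : StandardTableau μ} (hTT : ∀ c, (T.entry c).1 = (T'.entry c).1) : T = T' :=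
  entry_injective (Equiv.ext fun c => Subtype.ext (hTT c))

/-- The tableaux of shape `μ` with largest entry in row `r` are the tableaux of the shape without
the corner of row `r`. -/
noncomputable def removeMaxEquiv :
    {T : StandardTableau μ // T.rowOf μ.card = r} ≃ StandardTableau (μ.eraseCorner r h) where
  toFun T := T.1.removeMax h T.2
  invFun T := ⟨T.addMax h, (rowOf_card_eq_iff h _).2 (T.addMax_entry_corner h)⟩
  left_inv T := by
    refine Subtype.ext (ext_entry fun c => ?_)
    by_cases hc : c.1 = (r, μ.rowLen r - 1)
    · obtain ⟨c, hc'⟩ := c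
      obtain rfl : c = (r, μ.rowLen r - 1) := hc
      rw [addMax_entry_corner, (rowOf_card_eq_iff h _).1 T.2]
    · rw [addMax_entry_of_ne _ _ _ hc, removeMax_entry]
  right_inv T := by
    refine ext_entry fun c => ?_
    rw [removeMax_entry, addMax_entry_of_ne _ _ _ ((YoungDiagram.mem_eraseCorner h _).1 c.2).1]

theorem rowOf_removeMax (T : StandardTableau μ) (hT : T.rowOf μ.card = r) {k : ℕ}
    (hk : k < μ.card) : (T.removeMax h hT).rowOf k = T.rowOf k := by
  have hcard := YoungDiagram.card_eraseCorner h
  by_cases hk0 : k = 0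
  · simp [rowOf, hk0]
  · obtain ⟨c, hc⟩ := (T.removeMax h hT).exists_entry_eq (k := k) (by rw [Finset.mem_Icc]; omega)
    rw [← hc, rowOf_entry, removeMax_entry, rowOf_entry]

theorem maj_eq_maj_removeMax (T : StandardTableau μ) (hT : T.rowOf μ.card = r) :
    T.maj = (T.removeMax h hT).maj +
      if (T.removeMax h hT).rowOf (μ.eraseCorner r h).card < r then
        (μ.eraseCorner r h).card else 0 := by
  have hcard := YoungDiagram.card_eraseCorner h
  rw [maj_eq_sum, maj_eq_sum]
  rcases Nat.eq_zero_or_pos (μ.eraseCorner r h).card with h0 | h0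
  · rw [h0] at hcard
    rw [← hcard, h0]
    simp
  · have : ∀ i ∈ Finset.Ico 1 (μ.eraseCorner r h).card,
        (if (T.removeMax h hT).rowOf i < (T.removeMax h hT).rowOf (i + 1) then i else 0) =
          if T.rowOf i < T.rowOf (i + 1) then i else 0 := by
      intro i hi
      rw [Finset.mem_Ico] at hi
      rw [rowOf_removeMax _ _ _ (by omega), rowOf_removeMax _ _ _ (by omega)]
    rw [Finset.sum_congr rfl this, rowOf_removeMax _ _ _ (by omega)]
    conv_lhs => rw [← hcard, Finset.sum_Ico_succ_top h0, hcard, hT]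

end Corner

section GeneratingFunction

variable {K : Type*} [Field K] {q : K}

theorem rowOf_lt {N : ℕ} (hN : μ.rowLen N = 0) (hμ : 0 < μ.card) (T : StandardTableau μ) (k : ℕ) :
    T.rowOf k < N := by
  have key : ∀ c ∈ μ.cells, c.1 < N := by
    rintro ⟨i, j⟩ hc
    by_contra hi
    have h1 := μ.rowLen_anti N i (by simpa using hi)
    have h2 := YoungDiagram.mem_iff_lt_rowLen.1 ((YoungDiagram.mem_cells _).1 hc)
    omega
  rw [rowOf]
  split_ifs
  · exact key _ (Subtype.prop _)
  · obtain ⟨c, hc⟩ := Finset.card_pos.1 hμ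
    exact (Nat.zero_le _).trans_lt (key c hc)

theorem sum_rowOf_eq_zero {r : ℕ} (h : ¬ μ.rowLen (r + 1) < μ.rowLen r) (hμ : 0 < μ.card)
    (f : StandardTableau μ → K) :
    (∑ T : StandardTableau μ, if T.rowOf μ.card = r then f T else 0) = 0 := by
  refine Finset.sum_eq_zero fun T _ => if_neg ?_
  rintro rfl
  obtain ⟨c, hc⟩ := T.exists_entry_eq (k := μ.card) (by rw [Finset.mem_Icc]; omega)
  apply h
  conv_lhs => rw [← hc]
  conv_rhs => rw [← hc]
  rw [rowOf_entry]
  exact (T.corner_of_entry_eq_card c hc).1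

theorem sum_rowOf_eq_sum_eraseCorner {r : ℕ} (h : μ.rowLen (r + 1) < μ.rowLen r) :
    (∑ T : StandardTableau μ, if T.rowOf μ.card = r then q ^ T.maj else 0) =
      ∑ T : StandardTableau (μ.eraseCorner r h), q ^ T.maj *
        if T.rowOf (μ.eraseCorner r h).card < r then q ^ (μ.eraseCorner r h).card else 1 := by
  rw [← Finset.sum_filter, ← Finset.sum_subtype_eq_sum_filter, Finset.subtype_univ,
    ← Equiv.sum_comp (removeMaxEquiv h)]
  refine Finset.sum_congr rfl fun T _ => ?_
  rw [maj_eq_maj_removeMax h T.1 T.2, pow_add]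
  congr 1
  change _ = if (removeMax h T.1 T.2).rowOf (μ.eraseCorner r h).card < r then _ else _
  split_ifs <;> simp

theorem sum_eq_sum_rowOf {N : ℕ} (hN : μ.rowLen N = 0) (hμ : 0 < μ.card)
    (f : StandardTableau μ → K) :
    ∑ T : StandardTableau μ, f T =
      ∑ r ∈ Finset.range N, ∑ T : StandardTableau μ, if T.rowOf μ.card = r then f T else 0 := by
  rw [Finset.sum_comm]
  refine Finset.sum_congr rfl fun T _ => ?_
  rw [Finset.sum_ite_eq, if_pos (Finset.mem_range.2 (rowOf_lt hN hμ T _))]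

theorem existsUnique_of_card_eq_zero (hμ : μ.card = 0) : ∃ T₀ : StandardTableau μ, ∀ T, T = T₀ := by
  have hempty : ∀ c : {c : ℕ × ℕ // c ∈ μ.cells}, False := fun c => by
    rw [YoungDiagram.card, Finset.card_eq_zero] at hμ
    have := c.2
    simp [hμ] at this
  exact ⟨ofInjective (fun c => (hempty c).elim) (fun c => (hempty c).elim)
    (fun c => (hempty c).elim) (fun c => (hempty c).elim), fun T => ext_entry fun c => (hempty c).elim⟩

theorem sum_maj_of_card_eq_zero (hμ : μ.card = 0) (r : ℕ) :
    (∑ T : StandardTableau μ, q ^ T.maj * if T.rowOf μ.card < r then q ^ μ.card else 1) = 1 := by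
  obtain ⟨T₀, hT₀⟩ := existsUnique_of_card_eq_zero hμ
  have : (Finset.univ : Finset (StandardTableau μ)) = {T₀} := by
    ext T
    simp [hT₀ T]
  rw [this, Finset.sum_singleton, maj_eq_sum, hμ]
  simp

/-- The tableaux with largest entry in row `r` are counted by the horizontal strips whose first
nonempty row is row `r`. -/
theorem sum_rowOf_eq_stripSum (hq0 : q ≠ 0) (hq : ∀ k, 1 ≤ k → q ^ k ≠ 1) {N : ℕ} (n : ℕ) :
    ∀ (μ : YoungDiagram), μ.card = n + 1 → μ.rowLen N = 0 → ∀ r < N,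
      (∑ T : StandardTableau μ, if T.rowOf μ.card = r then q ^ T.maj else 0) =
        qPoch q n * (stripSum q N μ.rowLen r - stripSum q N μ.rowLen (r + 1)) := by
  induction n with
  | zero =>
    intro μ hμ hN r hr
    rw [stripSum_sub q μ.rowLen_anti hr]
    split_ifs with h
    · have hcard := YoungDiagram.card_eraseCorner h
      have hc0 : (μ.eraseCorner r h).card = 0 := by omega
      have hlen : (μ.eraseCorner r h).rowLen = 0 := by
        funext i
        refine Nat.eq_zero_of_not_pos fun hi => ?_
        have := Finset.card_pos.2 ⟨_, (YoungDiagram.mem_cells _).2 (YoungDiagram.mem_iff_lt_rowLen.2 hi)⟩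
        exact absurd hc0 this.ne'
      rw [sum_rowOf_eq_sum_eraseCorner h, sum_maj_of_card_eq_zero hc0,
        ← YoungDiagram.rowLen_eraseCorner h, hlen, stripSum_zero_shape hq0 hq]
      simp [qPoch]
    · rw [sum_rowOf_eq_zero h (by omega), mul_zero]
  | succ n ih =>
    intro μ hμ hN r hr
    rw [stripSum_sub q μ.rowLen_anti hr]
    split_ifs with h
    · have hcard := YoungDiagram.card_eraseCorner h
      have hlen := YoungDiagram.rowLen_eraseCorner h
      rw [← hlen]
      set ν := μ.eraseCorner r h with hν
      have hc1 : ν.card = n + 1 := by omega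
      have hN' : ν.rowLen N = 0 := by
        rw [hlen, Function.update_of_ne (by omega), hN]
      rw [sum_rowOf_eq_sum_eraseCorner h, sum_eq_sum_rowOf hN' (by omega)]
      have hstep : ∀ s ∈ Finset.range N, (∑ T : StandardTableau ν, if T.rowOf ν.card = s then
          q ^ T.maj * (if T.rowOf ν.card < r then q ^ ν.card else 1) else 0) =
          (if s < r then q ^ (n + 1) else 1) *
            (qPoch q n * (stripSum q N ν.rowLen s - stripSum q N ν.rowLen (s + 1))) := by
        intro s hs
        rw [← ih ν hc1 hN' s (Finset.mem_range.1 hs), Finset.mul_sum]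
        refine Finset.sum_congr rfl fun T _ => ?_
        by_cases hT : T.rowOf ν.card = s
        · rw [if_pos hT, if_pos hT, hT, hc1, mul_comm]
        · rw [if_neg hT, if_neg hT, mul_zero]
      rw [Finset.sum_congr rfl hstep,
        ← Finset.sum_range_add_sum_Ico _ hr.le]
      have e1 : ∑ s ∈ Finset.range r, (if s < r then q ^ (n + 1) else 1) *
            (qPoch q n * (stripSum q N ν.rowLen s - stripSum q N ν.rowLen (s + 1))) =
          q ^ (n + 1) * (qPoch q n * (stripSum q N ν.rowLen 0 - stripSum q N ν.rowLen r)) := by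
        rw [← Finset.sum_range_sub' (fun s => stripSum q N ν.rowLen s), Finset.mul_sum,
          Finset.mul_sum]
        exact Finset.sum_congr rfl fun s hs => by rw [if_pos (Finset.mem_range.1 hs)]
      have e2 : ∑ s ∈ Finset.Ico r N, (if s < r then q ^ (n + 1) else 1) *
            (qPoch q n * (stripSum q N ν.rowLen s - stripSum q N ν.rowLen (s + 1))) =
          qPoch q n * (stripSum q N ν.rowLen r - stripSum q N ν.rowLen N) := by
        rw [← neg_sub (stripSum q N ν.rowLen N),
          ← Finset.sum_Ico_sub (fun s => stripSum q N ν.rowLen s) hr.le, ← Finset.sum_neg_distrib,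
          Finset.mul_sum]
        refine Finset.sum_congr rfl fun s hs => ?_
        rw [if_neg (not_lt.2 (Finset.mem_Ico.1 hs).1), one_mul, neg_sub]
      rw [e1, e2, stripSum_self, ← YoungDiagram.card_eq_sum_rowLen hN', hc1,
        stripSum_zero hq0 hq ν.rowLen_anti hN', qPoch_succ]
      ring
    · rw [sum_rowOf_eq_zero h (by omega), mul_zero]

/-- The sum over the row of the largest entry telescopes, since each term is a difference of
consecutive strip sums. -/
theorem sum_pow_maj (hq0 : q ≠ 0) (hq : ∀ k, 1 ≤ k → q ^ k ≠ 1) {N : ℕ} (hN : μ.rowLen N = 0)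
    (hμ : 0 < μ.card) :
    ∑ T : StandardTableau μ, q ^ T.maj = qPoch q μ.card * shapeWeight q N μ.rowLen := by
  obtain ⟨n, hn⟩ : ∃ n, μ.card = n + 1 := ⟨μ.card - 1, by omega⟩
  rw [sum_eq_sum_rowOf hN hμ, Finset.sum_congr rfl fun r hr =>
    sum_rowOf_eq_stripSum hq0 hq n μ hn hN r (Finset.mem_range.1 hr), ← Finset.mul_sum,
    Finset.sum_range_sub' (fun s => stripSum q N μ.rowLen s), stripSum_self,
    ← YoungDiagram.card_eq_sum_rowLen hN, stripSum_zero hq0 hq μ.rowLen_anti hN, hn, qPoch_succ]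
  ring

end GeneratingFunction

end StandardTableau

/-! ### Hook lengths and the `q`-hook length formula -/

namespace YoungDiagram

variable {μ : YoungDiagram}

/-- The number of cells to the right of a cell, in its row. -/
def armLen (μ : YoungDiagram) (c : ℕ × ℕ) : ℕ := μ.rowLen c.1 - (c.2 + 1)

/-- The number of cells with a larger row index than a given cell, in its column. -/
def legLen (μ : YoungDiagram) (c : ℕ × ℕ) : ℕ := μ.colLen c.2 - (c.1 + 1)

/-- The hook length of a cell. -/
def hookLen (μ : YoungDiagram) (c : ℕ × ℕ) : ℕ := μ.armLen c + μ.legLen c + 1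

theorem lt_rowLen_iff_lt_colLen {i j : ℕ} : j < μ.rowLen i ↔ i < μ.colLen j := by
  rw [← mem_iff_lt_rowLen, mem_iff_lt_colLen]

theorem rowLen_colLen_zero (μ : YoungDiagram) : μ.rowLen (μ.colLen 0) = 0 := by
  by_contra h
  exact lt_irrefl _ (lt_rowLen_iff_lt_colLen.1 (Nat.pos_of_ne_zero h))

theorem colLen_le {N : ℕ} (hN : μ.rowLen N = 0) (j : ℕ) : μ.colLen j ≤ N := by
  by_contra h
  have := lt_rowLen_iff_lt_colLen.2 (not_le.1 h)
  omega

/-- In row `i`, the hook lengths and the differences `l i - l k` for `k > i` fill `{1, …, l i}`,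
where `l k` is the length of row `k` plus the number of later rows. -/
theorem prod_hookLen_row {M : Type*} [CommMonoid M] {N : ℕ} (hN : μ.rowLen N = 0) (i : Fin N)
    (f : ℕ → M) :
    ∏ k ∈ Finset.range (μ.rowLen i + (N - 1 - i)), f (k + 1) =
      (∏ j ∈ Finset.range (μ.rowLen i), f (μ.hookLen (i, j))) *
        ∏ k ∈ Finset.Ioi i, f ((μ.rowLen i + (N - 1 - i)) - (μ.rowLen k + (N - 1 - k))) := by
  classical
  set l : Fin N → ℕ := fun k => μ.rowLen k + (N - 1 - k) with hl
  have hi := i.2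
  have hlt : ∀ a b : Fin N, a < b → l b < l a := by
    intro a b hab
    have h1 := μ.rowLen_anti a b (Fin.le_def.1 hab.le)
    have h2 := Fin.lt_def.1 hab
    have h3 := b.2
    simp only [hl]
    omega
  set A := (Finset.range (μ.rowLen i)).image fun j => μ.hookLen (i, j) with hA
  set B := (Finset.Ioi i).image fun k => l i - l k with hB
  have hcol : ∀ j, j < μ.rowLen i → (i : ℕ) < μ.colLen j ∧ μ.colLen j ≤ N := fun j hj =>
    ⟨lt_rowLen_iff_lt_colLen.1 hj, colLen_le hN j⟩
  have hAinj : Set.InjOn (fun j => μ.hookLen (i, j)) (Finset.range (μ.rowLen i)) := by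
    intro a ha b hb hab
    simp only [Finset.coe_range, Set.mem_Iio] at ha hb
    have h1 := hcol a ha
    have h2 := hcol b hb
    simp only [hookLen, armLen, legLen] at hab
    rcases le_total a b with h | h
    · have h3 := μ.colLen_anti a b h
      omega
    · have h3 := μ.colLen_anti b a h
      omega
  have hBinj : Set.InjOn (fun k => l i - l k) (Finset.Ioi i) := by
    intro a ha b hb hab
    simp only [Finset.coe_Ioi, Set.mem_Ioi] at ha hb
    have h1 := hlt i a ha
    have h2 := hlt i b hb
    simp only at hab
    rcases lt_trichotomy a b with h | h | h
    · have := hlt a b h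
      omega
    · exact h
    · have := hlt b a h
      omega
  have hdisj : Disjoint A B := by
    rw [Finset.disjoint_left]
    intro x hxA hxB
    obtain ⟨j, hj, rfl⟩ := Finset.mem_image.1 hxA
    obtain ⟨k, hk, hkj⟩ := Finset.mem_image.1 hxB
    rw [Finset.mem_range] at hj
    rw [Finset.mem_Ioi] at hk
    have h1 := hcol j hj
    have h2 := μ.rowLen_anti i k (Fin.le_def.1 hk.le)
    have h3 := Fin.lt_def.1 hk
    have h4 := k.2
    have h5 := lt_rowLen_iff_lt_colLen (μ := μ) (i := k) (j := j)
    simp only [hookLen, armLen, legLen, hl] at hkj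
    by_cases h6 : j < μ.rowLen k
    · have h7 := h5.1 h6
      omega
    · have h7 := mt h5.2 h6
      omega
  have hunion : A ∪ B = (Finset.range (l i)).image fun k => k + 1 := by
    refine Finset.eq_of_subset_of_card_le ?_ ?_
    · intro x hx
      rw [Finset.mem_image]
      rcases Finset.mem_union.1 hx with hx | hx
      · obtain ⟨j, hj, rfl⟩ := Finset.mem_image.1 hx
        rw [Finset.mem_range] at hj
        have h1 := hcol j hj
        refine ⟨μ.armLen (i, j) + μ.legLen (i, j), ?_, rfl⟩
        rw [Finset.mem_range]
        simp only [armLen, legLen, hl]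
        omega
      · obtain ⟨k, hk, rfl⟩ := Finset.mem_image.1 hx
        have := hlt i k (Finset.mem_Ioi.1 hk)
        exact ⟨l i - l k - 1, by rw [Finset.mem_range]; omega, by omega⟩
    · rw [Finset.card_union_of_disjoint hdisj, hA, hB, Finset.card_image_of_injOn hAinj,
        Finset.card_image_of_injOn hBinj, Finset.card_image_of_injective _ (add_left_injective 1),
        Finset.card_range, Finset.card_range, Fin.card_Ioi]
  calc ∏ k ∈ Finset.range (l i), f (k + 1)
      = ∏ x ∈ (Finset.range (l i)).image fun k => k + 1, f x :=
        (Finset.prod_image (add_left_injective 1).injOn).symm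
    _ = ∏ x ∈ A ∪ B, f x := by rw [hunion]
    _ = (∏ x ∈ A, f x) * ∏ x ∈ B, f x := Finset.prod_union hdisj
    _ = _ := by rw [hA, hB, Finset.prod_image hAinj, Finset.prod_image hBinj]

/-- The alternant attached to a diagram is a power of `q` divided by the hook product. -/
theorem exists_alternantWeight_mul_hook {K : Type*} [Field K] {N : ℕ} (hN : μ.rowLen N = 0) :
    ∃ b : ℕ, ∀ q : K, (∀ k, 1 ≤ k → q ^ k ≠ 1) →
      alternantWeight q (fun i : Fin N => μ.rowLen i) * ∏ c ∈ μ.cells, (1 - q ^ μ.hookLen c) =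
        q ^ b := by
  set l : Fin N → ℕ := fun k => μ.rowLen k + (N - 1 - k) with hl
  refine ⟨∑ i : Fin N, ∑ k ∈ Finset.Ioi i, l k, fun q hq => ?_⟩
  have hdet : (Matrix.vandermonde fun i : Fin N => q ^ l i).det =
      (∏ i : Fin N, ∏ k ∈ Finset.Ioi i, q ^ l k) *
        ∏ i : Fin N, ∏ k ∈ Finset.Ioi i, (1 - q ^ (l i - l k)) := by
    rw [Matrix.det_vandermonde, ← Finset.prod_mul_distrib]
    refine Finset.prod_congr rfl fun i _ => ?_
    rw [← Finset.prod_mul_distrib]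
    refine Finset.prod_congr rfl fun k hk => ?_
    have hk' := Finset.mem_Ioi.1 hk
    have h1 := μ.rowLen_anti i k (Fin.le_def.1 hk'.le)
    have h2 := Fin.lt_def.1 hk'
    have h3 : l k ≤ l i := by simp only [hl]; omega
    rw [mul_sub, mul_one, ← pow_add, Nat.add_sub_cancel' h3]
  have hpoch : ∏ i : Fin N, qPoch q (l i) = (∏ c ∈ μ.cells, (1 - q ^ μ.hookLen c)) *
      ∏ i : Fin N, ∏ k ∈ Finset.Ioi i, (1 - q ^ (l i - l k)) := by
    rw [prod_cells hN, ← Finset.prod_mul_distrib]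
    exact Finset.prod_congr rfl fun i _ => prod_hookLen_row hN i fun k => 1 - q ^ k
  have hne : ∏ i : Fin N, qPoch q (l i) ≠ 0 :=
    Finset.prod_ne_zero_iff.2 fun i _ => qPoch_ne_zero hq _
  rw [alternantWeight, Finset.prod_inv_distrib]
  change (∏ i : Fin N, qPoch q (l i))⁻¹ * (Matrix.vandermonde fun i : Fin N => q ^ l i).det * _ = _
  rw [hdet]
  simp_rw [Finset.prod_pow_eq_pow_sum]
  rw [inv_mul_eq_div, div_mul_eq_mul_div, div_eq_iff hne, hpoch]
  ring

end YoungDiagram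

namespace StandardTableau

variable {μ : YoungDiagram}

/-- The `q`-hook length formula for the major index. -/
theorem exists_sum_pow_maj_mul_hook (μ : YoungDiagram) (hμ : 0 < μ.card) :
    ∃ a b : ℕ, ∀ z : ℂ,
      z ^ a * (∑ T : StandardTableau μ, z ^ T.maj) *
          ∏ c ∈ μ.cells, ∑ i ∈ Finset.range (μ.hookLen c), z ^ i =
        z ^ b * ∏ k ∈ Finset.range μ.card, ∑ i ∈ Finset.range (k + 1), z ^ i := by
  have hN := μ.rowLen_colLen_zero
  have hbot : (⊥ : YoungDiagram).rowLen = 0 := by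
    funext i
    by_contra h
    exact YoungDiagram.notMem_bot _ (YoungDiagram.mem_iff_lt_rowLen.2 (Nat.pos_of_ne_zero h))
  obtain ⟨b, hb⟩ := YoungDiagram.exists_alternantWeight_mul_hook (K := ℂ) hN
  obtain ⟨a, ha⟩ := YoungDiagram.exists_alternantWeight_mul_hook (K := ℂ)
    (congrFun hbot (μ.colLen 0))
  refine ⟨a, b, fun z => ?_⟩
  set P : Polynomial ℂ := Polynomial.X ^ a * (∑ T : StandardTableau μ, Polynomial.X ^ T.maj) *
    ∏ c ∈ μ.cells, ∑ i ∈ Finset.range (μ.hookLen c), Polynomial.X ^ i with hP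
  set Q : Polynomial ℂ := Polynomial.X ^ b *
    ∏ k ∈ Finset.range μ.card, ∑ i ∈ Finset.range (k + 1), Polynomial.X ^ i with hQ
  have hPe : ∀ w, P.eval w = w ^ a * (∑ T : StandardTableau μ, w ^ T.maj) *
      ∏ c ∈ μ.cells, ∑ i ∈ Finset.range (μ.hookLen c), w ^ i := fun w => by
    simp [hP, Polynomial.eval_finsetSum, Polynomial.eval_prod]
  have hQe : ∀ w, Q.eval w =
      w ^ b * ∏ k ∈ Finset.range μ.card, ∑ i ∈ Finset.range (k + 1), w ^ i := fun w => by
    simp [hQ, Polynomial.eval_finsetSum, Polynomial.eval_prod]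
  suffices P = Q by rw [← hPe, ← hQe, this]
  refine Polynomial.eq_of_infinite_eval_eq P Q (Set.infinite_of_injective_forall_mem
    (f := fun m : ℕ => ((m + 2 : ℕ) : ℂ)) (fun x y hxy => by simpa using hxy) fun m => ?_)
  change P.eval _ = Q.eval _
  rw [hPe, hQe]
  set q : ℂ := ((m + 2 : ℕ) : ℂ) with hqdef
  have hq0 : q ≠ 0 := Nat.cast_ne_zero.2 (by omega)
  have hq : ∀ k, 1 ≤ k → q ^ k ≠ 1 := by
    intro k hk h
    have h1 : (m + 2) ^ k = 1 := by
      rw [hqdef] at h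
      exact_mod_cast h
    rw [Nat.pow_eq_one] at h1
    omega
  have hq1 : 1 - q ≠ 0 := sub_ne_zero.2 fun h => hq 1 le_rfl (by rw [pow_one]; exact h.symm)
  have ha' : alternantWeight q (0 : Fin (μ.colLen 0) → ℕ) = q ^ a := by
    have := ha q hq
    rw [hbot] at this
    simpa [Pi.zero_def] using this
  have hgeom : ∀ k, (1 - q) * ∑ i ∈ Finset.range k, q ^ i = 1 - q ^ k := fun k =>
    mul_neg_geom_sum q k
  have h1 : (1 - q) ^ μ.card * ∏ c ∈ μ.cells, ∑ i ∈ Finset.range (μ.hookLen c), q ^ i =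
      ∏ c ∈ μ.cells, (1 - q ^ μ.hookLen c) := by
    rw [YoungDiagram.card, ← Finset.prod_const, ← Finset.prod_mul_distrib]
    exact Finset.prod_congr rfl fun c _ => hgeom _
  have h2 : (1 - q) ^ μ.card * ∏ k ∈ Finset.range μ.card, ∑ i ∈ Finset.range (k + 1), q ^ i =
      qPoch q μ.card := by
    have h3 := Finset.prod_const (s := Finset.range μ.card) (1 - q)
    rw [Finset.card_range] at h3
    rw [← h3, ← Finset.prod_mul_distrib, qPoch]
    exact Finset.prod_congr rfl fun k _ => hgeom _
  refine mul_left_cancel₀ (pow_ne_zero μ.card hq1) ?_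
  have hqa := pow_ne_zero a hq0
  calc (1 - q) ^ μ.card * (q ^ a * (∑ T : StandardTableau μ, q ^ T.maj) *
        ∏ c ∈ μ.cells, ∑ i ∈ Finset.range (μ.hookLen c), q ^ i)
      = q ^ a * (∑ T : StandardTableau μ, q ^ T.maj) * ∏ c ∈ μ.cells, (1 - q ^ μ.hookLen c) := by
        rw [← h1]
        ring
    _ = qPoch q μ.card * (alternantWeight q (fun i : Fin (μ.colLen 0) => μ.rowLen i) *
          ∏ c ∈ μ.cells, (1 - q ^ μ.hookLen c)) := by
        rw [sum_pow_maj hq0 hq hN hμ, shapeWeight, ha']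
        field_simp
    _ = _ := by rw [hb q hq, ← h2]; ring

end StandardTableau

/-! ### Inequalities for hook lengths -/

namespace YoungDiagram

variable {μ : YoungDiagram}

/-- If a cell has hook length at least `m`, then a maximal such cell `c` is the only cell of its
hook with this property, so the hook of `c` contains `m - 1` cells with hook length less
than `m`. -/
theorem card_le_hookLen (μ : YoungDiagram) (m : ℕ) :
    (μ.cells.filter fun c => m ≤ μ.hookLen c).card ≤ μ.card + 1 - m := by
  classical
  set S := μ.cells.filter fun c => m ≤ μ.hookLen c with hS
  rcases S.eq_empty_or_nonempty with h0 | hne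
  · simp [h0]
  obtain ⟨c, hcS, hmax⟩ := S.exists_max_image (fun c => c.1 + c.2) hne
  obtain ⟨hc, hcm⟩ := Finset.mem_filter.1 hcS
  set A : Finset (ℕ × ℕ) := (Finset.Ioo c.2 (μ.rowLen c.1)).image fun j => (c.1, j) with hA
  set L : Finset (ℕ × ℕ) := (Finset.Ioo c.1 (μ.colLen c.2)).image fun i => (i, c.2) with hL
  have hAc : A.card = μ.armLen c := by
    rw [hA, Finset.card_image_of_injective _ (fun x y h => congrArg Prod.snd h), Nat.card_Ioo,
      armLen]
    omega
  have hLc : L.card = μ.legLen c := by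
    rw [hL, Finset.card_image_of_injective _ (fun x y h => congrArg Prod.fst h), Nat.card_Ioo,
      legLen]
    omega
  have hAL : Disjoint A L := by
    rw [Finset.disjoint_left]
    rintro x hx hx'
    obtain ⟨j, hj, rfl⟩ := Finset.mem_image.1 hx
    obtain ⟨i, hi, h⟩ := Finset.mem_image.1 hx'
    rw [Finset.mem_Ioo] at hi
    have := congrArg Prod.fst h
    simp only at this
    omega
  have hSA : Disjoint S (A ∪ L) := by
    rw [Finset.disjoint_left]
    intro x hxS hx
    have h := hmax x hxS
    rcases Finset.mem_union.1 hx with hx | hx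
    · obtain ⟨j, hj, rfl⟩ := Finset.mem_image.1 hx
      rw [Finset.mem_Ioo] at hj
      simp only at h
      omega
    · obtain ⟨i, hi, rfl⟩ := Finset.mem_image.1 hx
      rw [Finset.mem_Ioo] at hi
      simp only at h
      omega
  have hsub : S ∪ (A ∪ L) ⊆ μ.cells := by
    refine Finset.union_subset (Finset.filter_subset _ _) (Finset.union_subset ?_ ?_)
    · intro x hx
      obtain ⟨j, hj, rfl⟩ := Finset.mem_image.1 hx
      exact (mem_cells _).2 (mem_iff_lt_rowLen.2 (Finset.mem_Ioo.1 hj).2)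
    · intro x hx
      obtain ⟨i, hi, rfl⟩ := Finset.mem_image.1 hx
      exact (mem_cells _).2 (mem_iff_lt_colLen.2 (Finset.mem_Ioo.1 hi).2)
  have hcard := Finset.card_le_card hsub
  rw [Finset.card_union_of_disjoint hSA, Finset.card_union_of_disjoint hAL, hAc, hLc] at hcard
  change _ ≤ μ.card at hcard
  rw [hookLen] at hcm
  omega

theorem hookLen_add_one_le {c : ℕ × ℕ} (hc : c ∈ μ.cells) :
    μ.hookLen c + 1 ≤ μ.rowLen 0 + μ.colLen 0 := by
  have h1 := mem_iff_lt_rowLen.1 ((mem_cells (c.1, c.2)).1 hc)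
  have h2 := mem_iff_lt_colLen.1 ((mem_cells (c.1, c.2)).1 hc)
  have h3 := μ.rowLen_anti 0 c.1 (Nat.zero_le _)
  have h4 := μ.colLen_anti 0 c.2 (Nat.zero_le _)
  simp only [hookLen, armLen, legLen]
  omega

theorem hookLen_le_card {c : ℕ × ℕ} (hc : c ∈ μ.cells) : μ.hookLen c ≤ μ.card := by
  by_contra h
  have h1 := μ.card_le_hookLen (μ.hookLen c)
  have h2 : 0 < (μ.cells.filter fun d => μ.hookLen c ≤ μ.hookLen d).card :=
    Finset.card_pos.2 ⟨c, Finset.mem_filter.2 ⟨hc, le_rfl⟩⟩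
  omega

/-- Abel summation over the level sets of `g`, which turns bounds on the number of large values of
`g` into bounds on `∑ f (g c)`. -/
theorem sum_eq_sum_increments {ι : Type*} (s : Finset ι) (g : ι → ℕ) {n : ℕ}
    (hg : ∀ c ∈ s, g c ≤ n) {f : ℕ → ℝ} (hf0 : f 0 = 0) :
    ∑ c ∈ s, f (g c) =
      ∑ m ∈ Finset.range n, (f (m + 1) - f m) * (s.filter fun c => m + 1 ≤ g c).card := by
  have h1 : ∀ c ∈ s, f (g c) =
      ∑ m ∈ Finset.range n, if m + 1 ≤ g c then f (m + 1) - f m else 0 := by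
    intro c hc
    rw [← Finset.sum_filter]
    have : (Finset.range n).filter (fun m => m + 1 ≤ g c) = Finset.range (g c) := by
      ext m
      have := hg c hc
      simp only [Finset.mem_filter, Finset.mem_range]
      omega
    rw [this, Finset.sum_range_sub, hf0, sub_zero]
  rw [Finset.sum_congr rfl h1, Finset.sum_comm]
  refine Finset.sum_congr rfl fun m _ => ?_
  rw [← Finset.sum_filter, Finset.sum_const, nsmul_eq_mul, mul_comm]

/-- The hook lengths are dominated by the integers `1, …, |μ|`. -/
theorem sum_hookLen_le {f : ℕ → ℝ} (hf0 : f 0 = 0)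
    (hf : ∀ m < μ.card, f m ≤ f (m + 1)) :
    ∑ c ∈ μ.cells, f (μ.hookLen c) ≤ ∑ k ∈ Finset.range μ.card, f (k + 1) := by
  rw [sum_eq_sum_increments μ.cells μ.hookLen (fun c hc => hookLen_le_card hc) hf0,
    sum_eq_sum_increments (Finset.range μ.card) (fun k => k + 1)
      (fun k hk => Nat.succ_le_of_lt (Finset.mem_range.1 hk)) hf0]
  refine Finset.sum_le_sum fun m hm => ?_
  rw [Finset.mem_range] at hm
  refine mul_le_mul_of_nonneg_left ?_ (sub_nonneg.2 (hf m hm))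
  have h1 := μ.card_le_hookLen (m + 1)
  have h2 : (Finset.range μ.card).filter (fun k => m + 1 ≤ k + 1) = Finset.Ico m μ.card := by
    ext k
    simp only [Finset.mem_filter, Finset.mem_range, Finset.mem_Ico]
    omega
  rw [h2, Nat.card_Ico]
  exact_mod_cast h1.trans (by omega)

theorem sum_hookLen_sq_lt (hμ : 0 < μ.card) (h : μ.rowLen 0 + μ.colLen 0 ≤ μ.card) :
    ∑ c ∈ μ.cells, (μ.hookLen c : ℝ) ^ 2 < ∑ k ∈ Finset.range μ.card, ((k : ℝ) + 1) ^ 2 := by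
  -- All hook lengths are at most `|μ| - 1`, so that the squares may be truncated there.
  set f : ℕ → ℝ := fun m => ((min m (μ.card - 1) : ℕ) : ℝ) ^ 2 with hf
  have h1 : ∑ c ∈ μ.cells, (μ.hookLen c : ℝ) ^ 2 = ∑ c ∈ μ.cells, f (μ.hookLen c) := by
    refine Finset.sum_congr rfl fun c hc => ?_
    have := hookLen_add_one_le hc
    simp only [hf]
    rw [min_eq_left (by omega)]
  rw [h1]
  refine (sum_hookLen_le (by simp [hf]) fun m _ => ?_).trans_lt
    (Finset.sum_lt_sum (fun k _ => ?_) ⟨μ.card - 1, Finset.mem_range.2 (by omega), ?_⟩)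
  · simp only [hf]
    gcongr
    omega
  · have : ((min (k + 1) (μ.card - 1) : ℕ) : ℝ) ≤ (k : ℝ) + 1 := by
      exact_mod_cast min_le_left _ _
    simp only [hf]
    gcongr
  · simp only [hf]
    rw [min_eq_right (by omega)]
    gcongr
    linarith

theorem sum_cells_transpose {M : Type*} [AddCommMonoid M] (f : ℕ × ℕ → M) :
    ∑ c ∈ μ.transpose.cells, f c.swap = ∑ c ∈ μ.cells, f c := by
  refine Finset.sum_nbij' Prod.swap Prod.swap ?_ ?_ ?_ ?_ ?_
  · intro c hc
    exact (mem_cells _).2 (mem_transpose.1 ((mem_cells _).1 hc))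
  · intro c hc
    exact (mem_cells _).2 (mem_transpose.2 (by rw [Prod.swap_swap]; exact (mem_cells _).1 hc))
  · intro c _
    exact Prod.swap_swap c
  · intro c _
    exact Prod.swap_swap c
  · intro c _
    rfl

theorem card_transpose (μ : YoungDiagram) : μ.transpose.card = μ.card := by
  have := sum_cells_transpose (μ := μ) (fun _ => 1)
  simpa using this

theorem sum_armLen_sq_le (μ : YoungDiagram) :
    3 * ∑ c ∈ μ.cells, (μ.armLen c : ℝ) ^ 2 ≤ μ.card * (μ.rowLen 0 : ℝ) ^ 2 := by
  have hrow : ∀ L : ℕ, 3 * ∑ j ∈ Finset.range L, ((L - (j + 1) : ℕ) : ℝ) ^ 2 ≤ (L : ℝ) ^ 3 := by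
    intro L
    have : ∑ j ∈ Finset.range L, ((L - (j + 1) : ℕ) : ℝ) ^ 2 = ∑ j ∈ Finset.range L, (j : ℝ) ^ 2 := by
      rw [← Finset.sum_range_reflect]
      refine Finset.sum_congr rfl fun j hj => ?_
      have := Finset.mem_range.1 hj
      rw [show L - (L - 1 - j + 1) = j by omega]
    rw [this]
    clear this
    induction L with
    | zero => simp
    | succ L ih =>
      rw [Finset.sum_range_succ]
      push_cast
      nlinarith [(Nat.cast_nonneg L : (0 : ℝ) ≤ L)]
  rw [sum_cells μ.rowLen_colLen_zero, card_eq_sum_rowLen μ.rowLen_colLen_zero, Finset.mul_sum,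
    Nat.cast_sum, Finset.sum_mul]
  refine Finset.sum_le_sum fun i _ => (hrow _).trans ?_
  have h1 : (μ.rowLen i : ℝ) ≤ μ.rowLen 0 := by exact_mod_cast μ.rowLen_anti 0 i (Nat.zero_le _)
  rw [pow_succ']
  gcongr

theorem sum_legLen_sq_le (μ : YoungDiagram) :
    3 * ∑ c ∈ μ.cells, (μ.legLen c : ℝ) ^ 2 ≤ μ.card * (μ.colLen 0 : ℝ) ^ 2 := by
  have h := μ.transpose.sum_armLen_sq_le
  rw [card_transpose, rowLen_transpose] at h
  rw [← sum_cells_transpose (μ := μ)]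
  simpa [armLen, legLen, rowLen_transpose] using h

/-- A cell is determined by a cell of its row and a cell of its column. -/
theorem sum_rowLen_mul_colLen_le (μ : YoungDiagram) :
    ∑ c ∈ μ.cells, μ.rowLen c.1 * μ.colLen c.2 ≤ μ.card ^ 2 := by
  have h : ∀ c : ℕ × ℕ, μ.rowLen c.1 * μ.colLen c.2 =
      ∑ d ∈ μ.cells, ∑ e ∈ μ.cells, if c = (d.1, e.2) then 1 else 0 := by
    intro c
    rw [rowLen_eq_card, colLen_eq_card, row, col, Finset.card_filter, Finset.card_filter,
      Finset.sum_mul_sum]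
    refine Finset.sum_congr rfl fun d _ => Finset.sum_congr rfl fun e _ => ?_
    by_cases h1 : d.1 = c.1 <;> by_cases h2 : e.2 = c.2 <;> simp [Prod.ext_iff, h1, h2]
    · exact fun h => h2 h.symm
    · exact fun h => absurd h.symm h1
    · exact fun h => absurd h.symm h1
  simp_rw [h]
  rw [Finset.sum_comm, sq, YoungDiagram.card, ← smul_eq_mul, ← Finset.sum_const]
  refine Finset.sum_le_sum fun d _ => ?_
  rw [Finset.sum_comm, Finset.card_eq_sum_ones]
  refine Finset.sum_le_sum fun e _ => ?_
  rw [Finset.sum_ite_eq']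
  split_ifs <;> omega

theorem sum_hookLen_sq_le (h1 : 2 * μ.rowLen 0 ≤ μ.card) (h2 : 2 * μ.colLen 0 ≤ μ.card) :
    ∑ c ∈ μ.cells, (μ.hookLen c : ℝ) ^ 2 ≤ (μ.card : ℝ) ^ 3 / 6 + 4 * (μ.card : ℝ) ^ 2 + μ.card := by
  set n : ℝ := (μ.card : ℝ) with hn
  have hn0 : 0 ≤ n := Nat.cast_nonneg _
  have hr : (μ.rowLen 0 : ℝ) ≤ n / 2 := by
    have : (2 * μ.rowLen 0 : ℝ) ≤ n := by rw [hn]; exact_mod_cast h1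
    linarith
  have hc : (μ.colLen 0 : ℝ) ≤ n / 2 := by
    have : (2 * μ.colLen 0 : ℝ) ≤ n := by rw [hn]; exact_mod_cast h2
    linarith
  have ha := μ.sum_armLen_sq_le
  have hl := μ.sum_legLen_sq_le
  have hal : ∑ c ∈ μ.cells, (μ.armLen c : ℝ) * μ.legLen c ≤ n ^ 2 := by
    have : ∑ c ∈ μ.cells, μ.armLen c * μ.legLen c ≤ μ.card ^ 2 :=
      (Finset.sum_le_sum fun c _ => Nat.mul_le_mul (Nat.sub_le _ _) (Nat.sub_le _ _)).trans
        μ.sum_rowLen_mul_colLen_le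
    rw [hn]
    exact_mod_cast this
  have h3 : ∀ c ∈ μ.cells, (μ.hookLen c : ℝ) ^ 2 ≤ (μ.armLen c : ℝ) ^ 2 + (μ.legLen c : ℝ) ^ 2 +
      2 * ((μ.armLen c : ℝ) * μ.legLen c) + (2 * n + 1) := by
    intro c _
    have e1 : (μ.armLen c : ℝ) ≤ n / 2 := by
      refine le_trans ?_ hr
      exact_mod_cast (Nat.sub_le _ _).trans (μ.rowLen_anti 0 c.1 (Nat.zero_le _))
    have e2 : (μ.legLen c : ℝ) ≤ n / 2 := by
      refine le_trans ?_ hc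
      exact_mod_cast (Nat.sub_le _ _).trans (μ.colLen_anti 0 c.2 (Nat.zero_le _))
    rw [hookLen]
    push_cast
    nlinarith
  refine (Finset.sum_le_sum h3).trans ?_
  rw [Finset.sum_add_distrib, Finset.sum_add_distrib, Finset.sum_add_distrib, Finset.sum_const,
    ← Finset.mul_sum, nsmul_eq_mul]
  change _ + (n * _) ≤ _
  have e1 : n * (μ.rowLen 0 : ℝ) ^ 2 ≤ n * (n / 2) ^ 2 := by gcongr
  have e2 : n * (μ.colLen 0 : ℝ) ^ 2 ≤ n * (n / 2) ^ 2 := by gcongr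
  nlinarith

end YoungDiagram

/-! ### The Fejér kernel -/

section FejerKernel

/-- The Fejér kernel `(1 - cos u) / (π u ^ 2)`, written as a square to be continuous at `0`. -/
noncomputable def fejer (u : ℝ) : ℝ := Real.sinc (u / 2) ^ 2 / (2 * Real.pi)

theorem fejer_nonneg (u : ℝ) : 0 ≤ fejer u := by
  unfold fejer
  positivity

theorem continuous_fejer : Continuous fejer := by
  unfold fejer
  have := Real.continuous_sinc
  fun_prop

theorem fejer_of_ne_zero {u : ℝ} (hu : u ≠ 0) : fejer u = (1 - Real.cos u) / (Real.pi * u ^ 2) := by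
  rw [fejer, Real.sinc_of_ne_zero (by positivity), div_pow, Real.sin_sq_eq_half_sub,
    mul_div_cancel₀ _ two_ne_zero]
  field_simp

/-- The Fejér kernel has a Fourier transform supported in `[-1, 1]`. -/
theorem fejer_eq_integral (u : ℝ) :
    fejer u = 1 / Real.pi * ∫ t in (0 : ℝ)..1, (1 - t) * Real.cos (u * t) := by
  by_cases hu : u = 0
  · simp only [hu, fejer, zero_div, Real.sinc_zero, zero_mul, Real.cos_zero, mul_one]
    have : ∫ t in (0 : ℝ)..1, (1 - t) = 1 / 2 := by
      rw [intervalIntegral.integral_sub (by simp) (by simp)]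
      simp
      norm_num
    rw [this]
    ring
  · have hderiv : ∀ t ∈ Set.uIcc (0 : ℝ) 1, HasDerivAt
        (fun t => (1 - t) * (Real.sin (u * t) / u) - Real.cos (u * t) / u ^ 2)
        ((1 - t) * Real.cos (u * t)) t := by
      intro t _
      have h1 : HasDerivAt (fun t : ℝ => u * t) u t := by simpa using (hasDerivAt_id t).const_mul u
      have h2 := (((hasDerivAt_id t).const_sub 1).mul (h1.sin.div_const u)).sub
        (h1.cos.div_const (u ^ 2))
      refine h2.congr_deriv ?_
      simp only [id]
      field_simp
      ring
    rw [intervalIntegral.integral_eq_sub_of_hasDerivAt hderiv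
      (Continuous.intervalIntegrable (by fun_prop) _ _), fejer_of_ne_zero hu]
    simp
    field_simp
    ring

theorem fejer_le_inv_sq {u : ℝ} (hu : u ≠ 0) : fejer u ≤ 2 / Real.pi * (u ^ 2)⁻¹ := by
  rw [fejer_of_ne_zero hu, ← div_eq_mul_inv, div_div]
  have := Real.pi_pos
  gcongr
  linarith [Real.neg_one_le_cos u]

theorem integrable_fejer : Integrable fejer := by
  refine (integrable_inv_one_add_sq.const_mul 2).mono' continuous_fejer.aestronglyMeasurable
    (Filter.Eventually.of_forall fun u => ?_)
  rw [Real.norm_eq_abs, abs_of_nonneg (fejer_nonneg u)]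
  have hpi := Real.pi_gt_three
  by_cases hu : |u| ≤ 1
  · have h1 : fejer u ≤ 1 := by
      have h2 : Real.sinc (u / 2) ^ 2 ≤ 1 := by
        rw [sq_le_one_iff_abs_le_one]
        exact Real.abs_sinc_le_one _
      rw [fejer, div_le_one (by positivity)]
      linarith
    have h3 : u ^ 2 ≤ 1 := by rwa [sq_le_one_iff_abs_le_one]
    rw [← div_eq_mul_inv, le_div_iff₀ (by positivity)]
    nlinarith [fejer_nonneg u]
  · have h3 : 1 ≤ u ^ 2 := by
      rw [one_le_sq_iff_one_le_abs]
      exact (not_le.1 hu).le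
    have hu0 : u ≠ 0 := by
      rintro rfl
      norm_num at h3
    refine (fejer_le_inv_sq hu0).trans ?_
    rw [← div_eq_mul_inv, ← div_eq_mul_inv, div_div, div_le_div_iff₀ (by positivity) (by positivity)]
    nlinarith

open FourierTransform in
/-- Fourier inversion for the triangle function, at `0`. -/
theorem integral_fejer : ∫ u, fejer u = 1 := by
  set f : ℝ → ℂ := fun x => ((max 0 (1 - |x|) : ℝ) : ℂ) with hf
  have hfc : Continuous f := by fun_prop
  have hfs : Function.support f ⊆ Set.Icc (-1) 1 := by
    intro x hx
    by_contra h
    apply hx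
    have h1 : 1 < |x| := by
      rw [← not_le, abs_le]
      exact h
    simp only [hf]
    rw [max_eq_left (by linarith)]
    simp
  have hfi : Integrable f :=
    hfc.integrable_of_hasCompactSupport (HasCompactSupport.of_support_subset_isCompact isCompact_Icc hfs)
  have hF : 𝓕 f = fun w => ((2 * Real.pi * fejer (2 * Real.pi * w) : ℝ) : ℂ) := by
    funext w
    rw [Real.fourier_real_eq_integral_exp_smul]
    set G : ℝ → ℂ := fun v => Complex.exp (((-2 * Real.pi * v * w : ℝ) : ℂ) * Complex.I) • f v with hG
    have hGi : Integrable G := by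
      refine hfi.norm.mono' (by fun_prop) (Filter.Eventually.of_forall fun v => ?_)
      rw [hG, norm_smul, Complex.norm_exp_ofReal_mul_I, one_mul]
    have hGpt : ∀ v ∈ Set.Ioi (0 : ℝ), G (-v) + G v =
        ((2 * max 0 (1 - v) * Real.cos (2 * Real.pi * w * v) : ℝ) : ℂ) := by
      intro v hv
      have hv' : |v| = v := abs_of_pos hv
      simp only [hG, hf, abs_neg, hv', smul_eq_mul]
      rw [← add_mul, show (((-2 * Real.pi * -v * w : ℝ) : ℂ)) = ((2 * Real.pi * w * v : ℝ) : ℂ) by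
        push_cast; ring, show (((-2 * Real.pi * v * w : ℝ) : ℂ)) = -((2 * Real.pi * w * v : ℝ) : ℂ) by
        push_cast; ring, ← Complex.two_cos]
      push_cast
      ring
    have hsplit : ∫ v, G v = ∫ v in Set.Ioi (0 : ℝ), (G (-v) + G v) := by
      rw [integral_add hGi.comp_neg.integrableOn hGi.integrableOn,
        integral_comp_neg_Ioi (0 : ℝ) G, neg_zero, intervalIntegral.integral_Iic_add_Ioi
          hGi.integrableOn hGi.integrableOn]
    rw [hsplit, setIntegral_congr_fun measurableSet_Ioi hGpt, integral_complex_ofReal]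
    congr 1
    rw [fejer_eq_integral, intervalIntegral.integral_of_le zero_le_one]
    have h1 : ∫ v in Set.Ioi (0 : ℝ), 2 * max 0 (1 - v) * Real.cos (2 * Real.pi * w * v) =
        ∫ v in Set.Ioc (0 : ℝ) 1, 2 * max 0 (1 - v) * Real.cos (2 * Real.pi * w * v) := by
      refine (setIntegral_eq_of_subset_of_forall_sdiff_eq_zero measurableSet_Ioi
        Set.Ioc_subset_Ioi_self fun v hv => ?_)
      have : 1 < v := by
        by_contra h
        exact hv.2 ⟨hv.1, not_lt.1 h⟩
      rw [max_eq_left (by linarith)]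
      ring
    have h2 : ∫ v in Set.Ioc (0 : ℝ) 1, 2 * max 0 (1 - v) * Real.cos (2 * Real.pi * w * v) =
        ∫ v in Set.Ioc (0 : ℝ) 1, 2 * ((1 - v) * Real.cos (2 * Real.pi * w * v)) := by
      refine setIntegral_congr_fun measurableSet_Ioc fun v hv => ?_
      rw [max_eq_right (by linarith [hv.2])]
      ring
    rw [h1, h2, integral_const_mul, ← mul_assoc, mul_one_div, mul_div_cancel_right₀ _ Real.pi_ne_zero]
  have hFi : Integrable (𝓕 f) := by
    rw [hF]
    exact ((integrable_fejer.comp_mul_left' (by positivity)).const_mul _).ofReal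
  have hinv := hfi.fourierInv_fourier_eq hFi (v := 0) hfc.continuousAt
  rw [Real.fourierInv_eq, hF] at hinv
  simp only [inner_zero_right, AddChar.map_zero_eq_one, one_smul] at hinv
  rw [integral_complex_ofReal, integral_const_mul,
    Measure.integral_comp_mul_left fejer (2 * Real.pi)] at hinv
  have hpi := Real.pi_pos
  rw [abs_of_pos (by positivity), smul_eq_mul, mul_inv_cancel_left₀ (by positivity)] at hinv
  simpa [hf] using hinv

/-- The probability measure on `ℝ` with density the Fejér kernel. -/
noncomputable def fejerMeasure : Measure ℝ := volume.withDensity fun u => ENNReal.ofReal (fejer u)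

theorem fejerMeasure_real {s : Set ℝ} (hs : MeasurableSet s) :
    fejerMeasure.real s = ∫ u in s, fejer u := by
  rw [fejerMeasure, Measure.real, withDensity_apply _ hs,
    ← ofReal_integral_eq_lintegral_ofReal integrable_fejer.integrableOn
      (Filter.Eventually.of_forall fejer_nonneg),
    ENNReal.toReal_ofReal (integral_nonneg fejer_nonneg)]

instance : IsProbabilityMeasure fejerMeasure where
  measure_univ := by
    rw [fejerMeasure, withDensity_apply _ MeasurableSet.univ,
      ← ofReal_integral_eq_lintegral_ofReal integrable_fejer.integrableOn
        (Filter.Eventually.of_forall fejer_nonneg), setIntegral_univ, integral_fejer,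
      ENNReal.ofReal_one]

theorem fejerMeasure_real_tail_le {a : ℝ} (ha : 0 < a) :
    fejerMeasure.real {u | a < |u|} ≤ 4 / (Real.pi * a) := by
  have hright : ∫ u in Set.Ioi a, fejer u ≤ 2 / (Real.pi * a) := by
    have h1 : IntegrableOn (fun u : ℝ => 2 / Real.pi * u ^ (-2 : ℝ)) (Set.Ioi a) :=
      (integrableOn_Ioi_rpow_of_lt (by norm_num) ha).const_mul _
    refine (setIntegral_mono_on integrable_fejer.integrableOn h1 measurableSet_Ioi
      fun u hu => ?_).trans ?_
    · have hu' : 0 < u := ha.trans hu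
      rw [Real.rpow_neg hu'.le, Real.rpow_two]
      exact fejer_le_inv_sq hu'.ne'
    · rw [integral_const_mul, integral_Ioi_rpow_of_lt (by norm_num) ha]
      norm_num [Real.rpow_neg_one]
      apply le_of_eq
      field_simp
  have heven : ∀ u, fejer (-u) = fejer u := fun u => by
    rw [fejer, fejer, neg_div, Real.sinc_neg]
  have hleft : ∫ u in Set.Iio (-a), fejer u ≤ 2 / (Real.pi * a) := by
    rw [← integral_Iic_eq_integral_Iio, ← integral_comp_neg_Ioi a fejer]
    simpa only [heven] using hright
  have hset : {u : ℝ | a < |u|} = Set.Iio (-a) ∪ Set.Ioi a := by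
    ext u
    simp only [Set.mem_ofPred_eq, Set.mem_union, Set.mem_Iio, Set.mem_Ioi, lt_abs]
    constructor
    · rintro (h | h)
      · exact Or.inr h
      · exact Or.inl (by linarith)
    · rintro (h | h)
      · exact Or.inr (by linarith)
      · exact Or.inl h
  rw [hset]
  refine (measureReal_union_le _ _).trans ?_
  rw [fejerMeasure_real measurableSet_Iio, fejerMeasure_real measurableSet_Ioi]
  refine (add_le_add hleft hright).trans (le_of_eq ?_)
  ring

theorem fejerMeasure_real_Iic (y : ℝ) :
    fejerMeasure.real (Set.Iic y) = fejerMeasure.real (Set.Iic 0) +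
      1 / Real.pi * ∫ t in (0 : ℝ)..1, (1 - t) * (y * Real.sinc (t * y)) := by
  have h1 : fejerMeasure.real (Set.Iic y) - fejerMeasure.real (Set.Iic 0) =
      ∫ u in (0 : ℝ)..y, fejer u := by
    rw [fejerMeasure_real measurableSet_Iic, fejerMeasure_real measurableSet_Iic,
      intervalIntegral.integral_Iic_sub_Iic integrable_fejer.integrableOn
        integrable_fejer.integrableOn]
  have h2 : ∫ u in (0 : ℝ)..y, fejer u =
      1 / Real.pi * ∫ t in (0 : ℝ)..1, ∫ u in (0 : ℝ)..y, (1 - t) * Real.cos (u * t) := by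
    simp_rw [fejer_eq_integral]
    rw [intervalIntegral.integral_const_mul, intervalIntegral_intervalIntegral_swap]
    have hcont : Continuous (Function.uncurry fun u t : ℝ => (1 - t) * Real.cos (u * t)) := by
      fun_prop
    exact (hcont.continuousOn.integrableOn_compact (isCompact_uIcc.prod isCompact_uIcc)).mono_set
      (Set.prod_mono Set.uIoc_subset_uIcc Set.uIoc_subset_uIcc)
  have h3 : ∀ t : ℝ, ∫ u in (0 : ℝ)..y, (1 - t) * Real.cos (u * t) =
      (1 - t) * (y * Real.sinc (t * y)) := by
    intro t
    rw [intervalIntegral.integral_const_mul]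
    congr 1
    by_cases ht : t = 0
    · simp [ht]
    · rw [intervalIntegral.integral_comp_mul_right _ ht, integral_cos]
      by_cases hy : y = 0
      · simp [hy]
      · rw [Real.sinc_of_ne_zero (mul_ne_zero ht hy)]
        simp
        field_simp
  simp_rw [h3] at h2
  linarith

end FejerKernel

/-! ### Esseen's smoothing inequality -/

section Smoothing

/-- Smoothing the distribution function of `P` by `ν` is averaging that of `ν` over `P`. -/
theorem integral_measureReal_Iic_sub (P ν : Measure ℝ) [IsProbabilityMeasure P]
    [IsProbabilityMeasure ν] {T : ℝ} (hT : 0 < T) (x : ℝ) :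
    ∫ u, P.real (Set.Iic (x - u / T)) ∂ν = ∫ X, ν.real (Set.Iic (T * (x - X))) ∂P := by
  set S : Set (ℝ × ℝ) := {p | p.1 + p.2 / T ≤ x} with hS
  have hSm : MeasurableSet S := measurableSet_le (by fun_prop) (by fun_prop)
  have h1 : ∀ u, P (Set.Iic (x - u / T)) = P ((fun X => (X, u)) ⁻¹' S) := by
    intro u
    congr 1
    ext X
    simp only [hS, Set.mem_Iic, Set.mem_preimage, Set.mem_ofPred_eq]
    exact le_sub_iff_add_le
  have h2 : ∀ X, ν (Set.Iic (T * (x - X))) = ν (Prod.mk X ⁻¹' S) := by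
    intro X
    congr 1
    ext u
    simp only [hS, Set.mem_Iic, Set.mem_preimage, Set.mem_ofPred_eq]
    rw [← div_le_iff₀' hT]
    exact le_sub_iff_add_le'
  simp_rw [Measure.real, h1, h2]
  rw [integral_toReal (measurable_measure_prodMk_right hSm).aemeasurable
      (Filter.Eventually.of_forall fun _ => measure_lt_top _ _),
    integral_toReal (measurable_measure_prodMk_left hSm).aemeasurable
      (Filter.Eventually.of_forall fun _ => measure_lt_top _ _),
    ← Measure.prod_apply hSm, ← Measure.prod_apply_symm hSm]

/-- The smoothed distribution function of `P` depends on `P` only through integrals that are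
imaginary parts of the characteristic function at frequencies below `T`. -/
theorem integral_fejerMeasure_Iic (P : Measure ℝ) [IsProbabilityMeasure P]
    (hP : Integrable (fun X => X) P) (T x : ℝ) :
    ∫ X, fejerMeasure.real (Set.Iic (T * (x - X))) ∂P = fejerMeasure.real (Set.Iic 0) +
      1 / Real.pi * ∫ t in (0 : ℝ)..1,
        (1 - t) * ∫ X, (T * (x - X)) * Real.sinc (t * (T * (x - X))) ∂P := by
  have hY : Integrable (fun X => T * (x - X)) P := ((integrable_const x).sub hP).const_mul T
  have hcont : Continuous (Function.uncurry fun t X : ℝ =>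
      (1 - t) * ((T * (x - X)) * Real.sinc (t * (T * (x - X))))) := by
    have := Real.continuous_sinc
    fun_prop
  have hint : Integrable (Function.uncurry fun t X : ℝ =>
      (1 - t) * ((T * (x - X)) * Real.sinc (t * (T * (x - X)))))
      ((volume.restrict (Set.uIoc 0 1)).prod P) := by
    have hb : Integrable (fun p : ℝ × ℝ => (1 - p.1) * (T * (x - p.2)))
        ((volume.restrict (Set.uIoc 0 1)).prod P) := by
      refine Integrable.mul_prod (f := fun t : ℝ => 1 - t) ?_ hY
      exact (Continuous.integrableOn_uIoc (by fun_prop))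
    refine hb.norm.mono' hcont.aestronglyMeasurable (Filter.Eventually.of_forall fun p => ?_)
    simp only [Function.uncurry, norm_mul, Real.norm_eq_abs]
    rw [← mul_assoc]
    refine mul_le_of_le_one_right (by positivity) (Real.abs_sinc_le_one _)
  have hpt : ∀ X, fejerMeasure.real (Set.Iic (T * (x - X))) = fejerMeasure.real (Set.Iic 0) +
      1 / Real.pi * ∫ t in (0 : ℝ)..1, (1 - t) * ((T * (x - X)) * Real.sinc (t * (T * (x - X)))) :=
    fun X => fejerMeasure_real_Iic _
  rw [integral_congr_ae (Filter.Eventually.of_forall hpt)]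
  simp_rw [← integral_const_mul]
  rw [intervalIntegral_integral_swap hint]
  have hint' : Integrable (fun X => ∫ t in (0 : ℝ)..1,
      (1 - t) * ((T * (x - X)) * Real.sinc (t * (T * (x - X))))) P := by
    have := hint.integral_prod_right
    simp only [intervalIntegral.integral_of_le zero_le_one]
    rwa [Set.uIoc_of_le zero_le_one] at this
  rw [integral_add (integrable_const _) (hint'.const_mul _), integral_const_mul]
  simp

theorem abs_integral_sub_integral_sinc_le (P Q : Measure ℝ) [IsProbabilityMeasure P]
    [IsProbabilityMeasure Q] {t : ℝ} (ht : 0 < t) (T x : ℝ) :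
    |(∫ X, (T * (x - X)) * Real.sinc (t * (T * (x - X))) ∂P) -
      ∫ X, (T * (x - X)) * Real.sinc (t * (T * (x - X))) ∂Q| ≤
      ‖charFun P (T * t) - charFun Q (T * t)‖ / t := by
  have hpt : ∀ X : ℝ, (T * (x - X)) * Real.sinc (t * (T * (x - X))) =
      (Complex.exp (((-(T * t)) * X : ℝ) * Complex.I) *
        Complex.exp ((T * t * x : ℝ) * Complex.I)).im / t := by
    intro X
    rw [← Complex.exp_add, ← add_mul, ← Complex.ofReal_add, Complex.exp_ofReal_mul_I_im]
    by_cases h0 : T * (x - X) = 0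
    · have : -(T * t) * X + T * t * x = 0 := by
        linear_combination t * h0
      rw [this, h0]
      simp
    · rw [Real.sinc_of_ne_zero (mul_ne_zero ht.ne' h0)]
      have : -(T * t) * X + T * t * x = t * (T * (x - X)) := by ring
      rw [this]
      generalize T * (x - X) = Y at h0
      field_simp
  have hE : ∀ ρ : Measure ℝ, IsProbabilityMeasure ρ →
      ∫ X, (T * (x - X)) * Real.sinc (t * (T * (x - X))) ∂ρ =
        (charFun ρ (-(T * t)) * Complex.exp ((T * t * x : ℝ) * Complex.I)).im / t := by
    intro ρ _
    simp_rw [hpt]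
    rw [integral_div, charFun_apply_real, ← integral_mul_const]
    congr 1
    have hi : Integrable (fun X : ℝ => Complex.exp (((-(T * t)) * X : ℝ) * Complex.I) *
        Complex.exp ((T * t * x : ℝ) * Complex.I)) ρ := by
      refine (integrable_const (1 : ℝ)).mono' (by fun_prop)
        (Filter.Eventually.of_forall fun X => ?_)
      rw [norm_mul, Complex.norm_exp_ofReal_mul_I, Complex.norm_exp_ofReal_mul_I, one_mul]
    have := integral_im (𝕜 := ℂ) hi
    simp only [RCLike.im_to_complex] at this
    rw [this]
    push_cast
    rfl
  rw [hE P inferInstance, hE Q inferInstance, ← sub_div, abs_div, abs_of_pos ht]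
  refine div_le_div_of_nonneg_right ?_ ht.le
  rw [← Complex.sub_im, ← sub_mul]
  refine (Complex.abs_im_le_norm _).trans ?_
  rw [norm_mul, Complex.norm_exp_ofReal_mul_I, mul_one, charFun_neg, charFun_neg, ← map_sub,
    RCLike.norm_conj]

/-- **Esseen's smoothing inequality.** -/
theorem abs_measureReal_Iic_sub_le (P Q : Measure ℝ) [IsProbabilityMeasure P]
    [IsProbabilityMeasure Q] (hP : Integrable (fun X => X) P) (hQ : Integrable (fun X => X) Q)
    {m : ℝ} (hm : ∀ x y, x ≤ y → Q.real (Set.Iic y) ≤ Q.real (Set.Iic x) + m * (y - x))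
    {T : ℝ} (hT : 0 < T) {g : ℝ → ℝ} (hg : IntervalIntegrable g volume 0 1)
    (hφ : ∀ t ∈ Set.Ioc (0 : ℝ) 1, ‖charFun P (T * t) - charFun Q (T * t)‖ ≤ t * g t) (x : ℝ) :
    |P.real (Set.Iic x) - Q.real (Set.Iic x)| ≤
      2 / Real.pi * (∫ t in (0 : ℝ)..1, g t) + 64 * m / (Real.pi * T) := by
  have hpi := Real.pi_pos
  set D : ℝ → ℝ := fun x => P.real (Set.Iic x) - Q.real (Set.Iic x) with hD
  have hDm : Measurable D := by
    refine Measurable.sub (Monotone.measurable fun a b hab => ?_)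
      (Monotone.measurable fun a b hab => ?_) <;>
    exact measureReal_mono (Set.Iic_subset_Iic.2 hab)
  have hD1 : ∀ x, |D x| ≤ 1 := by
    intro x
    rw [abs_sub_le_iff]
    have h1 := measureReal_nonneg (μ := P) (s := Set.Iic x)
    have h2 := measureReal_nonneg (μ := Q) (s := Set.Iic x)
    have h3 := measureReal_le_one (μ := P) (s := Set.Iic x)
    have h4 := measureReal_le_one (μ := Q) (s := Set.Iic x)
    constructor <;> linarith
  have hDi : ∀ x, Integrable (fun u => D (x - u / T)) fejerMeasure := fun x =>
    (integrable_const (1 : ℝ)).mono' (hDm.comp (by fun_prop)).aestronglyMeasurable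
      (Filter.Eventually.of_forall fun u => hD1 _)
  -- The smoothed difference is bounded by the characteristic functions.
  set J := 1 / Real.pi * ∫ t in (0 : ℝ)..1, g t with hJ
  have hsmooth : ∀ x, |∫ u, D (x - u / T) ∂fejerMeasure| ≤ J := by
    intro x
    have hi : ∀ ρ : Measure ℝ, IsProbabilityMeasure ρ →
        Integrable (fun u => ρ.real (Set.Iic (x - u / T))) fejerMeasure := by
      intro ρ _
      refine (integrable_const (1 : ℝ)).mono' (Measurable.aestronglyMeasurable ?_)
        (Filter.Eventually.of_forall fun u => ?_)
      · exact (Monotone.measurable (f := fun y => ρ.real (Set.Iic y)) fun a b hab =>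
          measureReal_mono (Set.Iic_subset_Iic.2 hab)).comp (by fun_prop)
      · rw [Real.norm_eq_abs, abs_of_nonneg measureReal_nonneg]
        exact measureReal_le_one
    have hii : ∀ ρ : Measure ℝ, IsProbabilityMeasure ρ → Integrable (fun X => X) ρ →
        IntervalIntegrable (fun t => (1 - t) *
          ∫ X, (T * (x - X)) * Real.sinc (t * (T * (x - X))) ∂ρ) volume 0 1 := by
      intro ρ _ hρ
      refine Continuous.intervalIntegrable (Continuous.mul (by fun_prop) ?_) _ _
      refine continuous_of_dominated (bound := fun X => |T * (x - X)|) (fun t => ?_) (fun t => ?_)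
        (((integrable_const x).sub hρ).const_mul T).norm ?_
      · have := Real.continuous_sinc
        exact Continuous.aestronglyMeasurable (by fun_prop)
      · refine Filter.Eventually.of_forall fun X => ?_
        rw [Real.norm_eq_abs, abs_mul]
        exact mul_le_of_le_one_right (abs_nonneg _) (Real.abs_sinc_le_one _)
      · have := Real.continuous_sinc
        exact Filter.Eventually.of_forall fun X => by fun_prop
    rw [integral_sub (hi P inferInstance) (hi Q inferInstance), integral_measureReal_Iic_sub P _ hT,
      integral_measureReal_Iic_sub Q _ hT, integral_fejerMeasure_Iic P hP,
      integral_fejerMeasure_Iic Q hQ, add_sub_add_left_eq_sub, ← mul_sub,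
      ← intervalIntegral.integral_sub (hii P inferInstance hP) (hii Q inferInstance hQ), abs_mul,
      abs_of_pos (by positivity)]
    refine mul_le_mul_of_nonneg_left ?_ (by positivity)
    rw [← Real.norm_eq_abs]
    refine intervalIntegral.norm_integral_le_of_norm_le zero_le_one
      (Filter.Eventually.of_forall fun t ht => ?_) hg
    have ht0 : 0 < t := ht.1
    rw [← mul_sub, Real.norm_eq_abs, abs_mul, abs_of_nonneg (by linarith [ht.2] : 0 ≤ 1 - t)]
    refine (mul_le_of_le_one_left (abs_nonneg _) (by linarith)).trans ?_
    refine (abs_integral_sub_integral_sinc_le P Q ht0 T x).trans ?_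
    rw [div_le_iff₀ ht0, mul_comm (g t)]
    exact hφ t ht
  -- The supremum `Δ` of the difference is compared with the smoothed difference at a point shifted
  -- by `a / T`, where `a` is such that the kernel has mass at most `1 / 4` outside `[-a, a]`.
  set Δ := ⨆ x, |D x| with hΔ
  have hbdd : BddAbove (Set.range fun x => |D x|) := ⟨1, by rintro _ ⟨x, rfl⟩; exact hD1 x⟩
  have hle : ∀ x, |D x| ≤ Δ := fun x => le_ciSup hbdd x
  have hm0 : 0 ≤ m := by
    have h1 := hm 0 1 zero_le_one
    have h2 := measureReal_mono (μ := Q) (Set.Iic_subset_Iic.2 (zero_le_one' ℝ))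
    by_contra hneg
    linarith
  set a : ℝ := 16 / Real.pi with ha
  have ha0 : 0 < a := by positivity
  have htail : fejerMeasure.real {u | a < |u|} ≤ 1 / 4 := by
    refine (fejerMeasure_real_tail_le ha0).trans (le_of_eq ?_)
    rw [ha]
    field_simp
    norm_num
  have hmeas : MeasurableSet {u : ℝ | a < |u|} := measurableSet_lt measurable_const (by fun_prop)
  have hΔ0 : 0 ≤ Δ := (abs_nonneg _).trans (hle 0)
  have hcomp : ∀ (E : ℝ → ℝ) (c z : ℝ), (∀ y, |E y| ≤ Δ) →
      Integrable (fun u => E (z - u / T)) fejerMeasure →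
      (∀ u, |u| ≤ a → c ≤ E (z - u / T) + 2 * a * m / T) → c ≤ Δ →
      c ≤ (∫ u, E (z - u / T) ∂fejerMeasure) + 2 * a * m / T + Δ / 2 := by
    intro E c z hE hEi hc hcΔ
    have h1 : ∀ u, c - 2 * a * m / T - Set.indicator {u : ℝ | a < |u|} (fun _ => 2 * Δ) u ≤
        E (z - u / T) := by
      intro u
      by_cases hu : a < |u|
      · rw [Set.indicator_of_mem (show u ∈ {u : ℝ | a < |u|} from hu)]
        have := (abs_le.1 (hE (z - u / T))).1
        have h2 : 0 ≤ 2 * a * m / T := by positivity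
        linarith
      · rw [Set.indicator_of_notMem (show u ∉ {u : ℝ | a < |u|} from hu)]
        have := hc u (not_lt.1 hu)
        linarith
    have hind : Integrable (Set.indicator {u : ℝ | a < |u|} (fun _ => 2 * Δ)) fejerMeasure :=
      (integrable_const _).indicator hmeas
    have h2 := integral_mono (((integrable_const _).sub hind)) hEi h1
    simp only [Pi.sub_apply] at h2
    rw [integral_sub (integrable_const _) hind, integral_const, integral_indicator_const _ hmeas] at h2
    simp only [probReal_univ, smul_eq_mul, one_mul] at h2
    nlinarith
  have hfin : ∀ x, |D x| ≤ J + 2 * a * m / T + Δ / 2 := by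
    intro x
    rw [abs_le']
    constructor
    · refine (hcomp D (D x) (x + a / T) hle (hDi _) (fun u hu => ?_)
        ((le_abs_self _).trans (hle x))).trans ?_
      · have hu' := abs_le.1 hu
        have h1 : x ≤ x + a / T - u / T := by
          have : 0 ≤ (a - u) / T := div_nonneg (by linarith) hT.le
          rw [sub_div] at this
          linarith
        have h2 := measureReal_mono (μ := P) (Set.Iic_subset_Iic.2 h1)
        have h3 := hm _ _ h1
        have h4 : m * (x + a / T - u / T - x) ≤ 2 * a * m / T := by
          rw [show x + a / T - u / T - x = (a - u) / T by ring, mul_div_assoc', mul_comm m]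
          gcongr
          linarith
        simp only [hD]
        linarith
      · have := (le_abs_self _).trans (hsmooth (x + a / T))
        linarith
    · refine (hcomp (fun y => - D y) (- D x) (x - a / T) (fun y => by rw [abs_neg]; exact hle y)
        (hDi _).neg (fun u hu => ?_) ((neg_le_abs _).trans (hle x))).trans ?_
      · have hu' := abs_le.1 hu
        have h1 : x - a / T - u / T ≤ x := by
          have : 0 ≤ (a + u) / T := div_nonneg (by linarith) hT.le
          rw [add_div] at this
          linarith
        have h2 := measureReal_mono (μ := P) (Set.Iic_subset_Iic.2 h1)
        have h3 := hm _ _ h1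
        have h4 : m * (x - (x - a / T - u / T)) ≤ 2 * a * m / T := by
          rw [show x - (x - a / T - u / T) = (a + u) / T by ring, mul_div_assoc', mul_comm m]
          gcongr
          linarith
        simp only [hD]
        linarith
      · rw [integral_neg]
        have := (neg_le_abs _).trans (hsmooth (x - a / T))
        linarith
  have hΔle : Δ ≤ J + 2 * a * m / T + Δ / 2 := ciSup_le hfin
  have hlast : 2 * (J + 2 * a * m / T) =
      2 / Real.pi * (∫ t in (0 : ℝ)..1, g t) + 64 * m / (Real.pi * T) := by
    rw [hJ, ha]
    field_simp
    ring
  calc |D x| ≤ Δ := hle x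
    _ ≤ 2 * (J + 2 * a * m / T) := by linarith
    _ = _ := hlast

end Smoothing

/-! ### The logarithm of `sinc`, and moments from characteristic functions -/

section LogSinc

/-- The part of `-log (sin x / x)` beyond its quadratic term `x ^ 2 / 6`. -/
noncomputable def logSincTail (x : ℝ) : ℝ := -Real.log (Real.sinc x) - x ^ 2 / 6

theorem sinc_pos {x : ℝ} (hx0 : 0 ≤ x) (hx : x < Real.pi) : 0 < Real.sinc x := by
  rcases hx0.eq_or_lt with rfl | hx0
  · simp
  · rw [Real.sinc_of_ne_zero hx0.ne']
    exact div_pos (Real.sin_pos_of_pos_of_lt_pi hx0 hx) hx0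

theorem sinc_eq_exp {x : ℝ} (hx0 : 0 ≤ x) (hx : x < Real.pi) :
    Real.sinc x = Real.exp (-(x ^ 2 / 6) - logSincTail x) := by
  rw [logSincTail, show -(x ^ 2 / 6) - (-Real.log (Real.sinc x) - x ^ 2 / 6) =
    Real.log (Real.sinc x) by ring, Real.exp_log (sinc_pos hx0 hx)]

theorem logSincTail_zero : logSincTail 0 = 0 := by simp [logSincTail]

theorem logSincTail_le {x : ℝ} (hx0 : 0 ≤ x) (hx : x ≤ 3 / 2) : logSincTail x ≤ x ^ 4 / 18 := by
  rcases hx0.eq_or_lt with rfl | hx0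
  · simp [logSincTail_zero]
  set u := x ^ 2 / 6 with hu
  have hu1 : u ≤ 1 / 2 := by
    rw [hu]
    nlinarith
  have hu0 : 0 ≤ u := by positivity
  have h1 : 1 - u ≤ Real.sinc x := by
    rw [Real.sinc_of_ne_zero hx0.ne', le_div_iff₀ hx0]
    have := Real.sin_ge_sub_cube hx0.le
    rw [hu]
    nlinarith
  have h2 : Real.log (1 - u) ≤ Real.log (Real.sinc x) := Real.log_le_log (by linarith) h1
  have h3 := Real.one_sub_inv_le_log_of_pos (show 0 < 1 - u by linarith)
  have h4 : (1 - u)⁻¹ ≤ 1 + u + 2 * u ^ 2 := by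
    rw [inv_le_iff_one_le_mul₀ (by linarith)]
    nlinarith [mul_nonneg (sq_nonneg u) (show 0 ≤ 1 - 2 * u by linarith)]
  rw [logSincTail, show x ^ 4 / 18 = 2 * u ^ 2 by rw [hu]; ring, ← hu]
  linarith

theorem mul_cos_le_sin {x : ℝ} (hx0 : 0 ≤ x) (hx : x ≤ Real.pi) : x * Real.cos x ≤ Real.sin x := by
  have hmono : MonotoneOn (fun x => Real.sin x - x * Real.cos x) (Set.Icc 0 Real.pi) := by
    refine monotoneOn_of_hasDerivWithinAt_nonneg (f' := fun x => x * Real.sin x) (convex_Icc _ _)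
      (by fun_prop) (fun y hy => ?_) fun y hy => ?_
    · refine (((Real.hasDerivAt_sin y).sub
        ((hasDerivAt_id y).mul (Real.hasDerivAt_cos y))).congr_deriv ?_).hasDerivWithinAt
      simp
    · rw [interior_Icc] at hy
      exact mul_nonneg hy.1.le (Real.sin_pos_of_mem_Ioo hy).le
  have := hmono ⟨le_rfl, Real.pi_pos.le⟩ ⟨hx0, hx⟩ hx0
  simp at this
  exact this

theorem sq_mul_sin_le {x : ℝ} (hx0 : 0 ≤ x) (hx : x ≤ Real.pi) :
    x ^ 2 * Real.sin x ≤ 3 * (Real.sin x - x * Real.cos x) := by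
  have hmono : MonotoneOn (fun x => (3 - x ^ 2) * Real.sin x - 3 * x * Real.cos x)
      (Set.Icc 0 Real.pi) := by
    refine monotoneOn_of_hasDerivWithinAt_nonneg
      (f' := fun x => x * (Real.sin x - x * Real.cos x)) (convex_Icc _ _)
      (by fun_prop) (fun y hy => ?_) fun y hy => ?_
    · refine (((((hasDerivAt_id y).pow 2).const_sub 3).mul (Real.hasDerivAt_sin y)).sub
        (((hasDerivAt_id y).const_mul 3).mul (Real.hasDerivAt_cos y))).congr_deriv ?_
        |>.hasDerivWithinAt
      simp
      ring
    · rw [interior_Icc] at hy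
      exact mul_nonneg hy.1.le (sub_nonneg.2 (mul_cos_le_sin hy.1.le hy.2.le))
  have := hmono ⟨le_rfl, Real.pi_pos.le⟩ ⟨hx0, hx⟩ hx0
  simp at this
  linarith

theorem monotoneOn_logSincTail : MonotoneOn logSincTail (Set.Icc 0 (3 / 2)) := by
  have hpi := Real.pi_gt_three
  refine monotoneOn_of_hasDerivWithinAt_nonneg
    (f' := fun x => (3 * (Real.sin x - x * Real.cos x) - x ^ 2 * Real.sin x) / (3 * x * Real.sin x))
    (convex_Icc _ _) ?_ (fun y hy => ?_) fun y hy => ?_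
  · unfold logSincTail
    refine ((Real.continuous_sinc.continuousOn.log fun x hx => ?_).neg).sub (by fun_prop)
    exact (sinc_pos hx.1 (by linarith [hx.2])).ne'
  · rw [interior_Icc] at hy
    have hy0 : y ≠ 0 := hy.1.ne'
    have hsin : 0 < Real.sin y := Real.sin_pos_of_pos_of_lt_pi hy.1 (by linarith [hy.2])
    have h1 : HasDerivAt (fun x => -Real.log (Real.sin x / x) - x ^ 2 / 6)
        ((3 * (Real.sin y - y * Real.cos y) - y ^ 2 * Real.sin y) / (3 * y * Real.sin y)) y := by
      refine (((((Real.hasDerivAt_sin y).div (hasDerivAt_id y) hy0).log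
        (div_ne_zero hsin.ne' hy0)).neg.sub (((hasDerivAt_id y).pow 2).div_const 6))).congr_deriv ?_
      simp
      field_simp
      ring
    refine (h1.congr_of_eventuallyEq ?_).hasDerivWithinAt
    filter_upwards [isOpen_ne.mem_nhds hy0] with x hx
    rw [logSincTail, Real.sinc_of_ne_zero hx]
  · rw [interior_Icc] at hy
    have hsin : 0 < Real.sin y := Real.sin_pos_of_pos_of_lt_pi hy.1 (by linarith [hy.2])
    have := hy.1
    have h2 := sq_mul_sin_le hy.1.le (by linarith [hy.2])
    exact div_nonneg (by linarith) (by positivity)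

end LogSinc

section Moments

theorem eq_zero_of_abs_le_mul {A B t₀ : ℝ} (ht₀ : 0 < t₀)
    (h : ∀ t, 0 < t → t ≤ t₀ → |A| ≤ B * t) : A = 0 := by
  have h1 : Filter.Tendsto (fun t : ℝ => B * t) (nhdsWithin 0 (Set.Ioi 0)) (nhds 0) := by
    have : Filter.Tendsto (fun t : ℝ => B * t) (nhds 0) (nhds (B * 0)) :=
      (continuous_const.mul continuous_id).tendsto 0
    rw [mul_zero] at this
    exact this.mono_left nhdsWithin_le_nhds
  have h2 : |A| ≤ 0 := by
    refine ge_of_tendsto h1 ?_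
    filter_upwards [Ioc_mem_nhdsGT ht₀] with t ht
    exact h t ht.1 ht.2
  exact abs_nonpos_iff.1 h2

/-- The first two moments of a finite family are read off the expansion of its characteristic
function at `0`. -/
theorem sum_eq_zero_and_sum_sq_eq {ι : Type*} [Fintype ι] (X : ι → ℝ) {v K t₀ : ℝ} {G : ℝ → ℝ}
    (ht₀ : 0 < t₀) (hv : 0 ≤ v)
    (hG0 : ∀ t, 0 < t → t ≤ t₀ → 0 ≤ G t) (hGK : ∀ t, 0 < t → t ≤ t₀ → G t ≤ K * t ^ 4)
    (hX : ∀ t, 0 < t → t ≤ t₀ → ∑ i, Complex.exp ((t * X i : ℝ) * Complex.I) =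
      ((Fintype.card ι * Real.exp (-(v * t ^ 2 / 2) - G t) : ℝ) : ℂ)) :
    ∑ i, X i = 0 ∧ ∑ i, X i ^ 2 = Fintype.card ι * v := by
  set M := ∑ i, |X i| with hM
  have hM0 : 0 ≤ M := Finset.sum_nonneg fun i _ => abs_nonneg _
  have hXM : ∀ i, |X i| ≤ M := fun i =>
    Finset.single_le_sum (f := fun i => |X i|) (fun i _ => abs_nonneg _) (Finset.mem_univ i)
  set N : ℝ := ((Fintype.card ι : ℕ) : ℝ) with hN
  have hN0 : 0 ≤ N := Nat.cast_nonneg _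
  have hK0 : 0 ≤ K := by
    have h1 := (hG0 t₀ ht₀ le_rfl).trans (hGK t₀ ht₀ le_rfl)
    by_contra h
    have : K * t₀ ^ 4 < 0 := mul_neg_of_neg_of_pos (not_le.1 h) (by positivity)
    linarith
  -- For `t ≤ t₁` all `t * X i` and the exponent are at most `1`, where Taylor bounds apply.
  set t₁ := min t₀ (1 / (1 + M + v + K)) with ht₁
  have ht₁0 : 0 < t₁ := lt_min ht₀ (by positivity)
  have hsmall : ∀ t, 0 < t → t ≤ t₁ → t ≤ t₀ ∧ t ≤ 1 ∧ (∀ i, |t * X i| ≤ 1) ∧ t * (v + K) ≤ 1 := by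
    intro t ht0 ht
    have h1 : t * (1 + M + v + K) ≤ 1 := by
      rw [← le_div_iff₀ (by positivity)]
      exact ht.trans (min_le_right _ _)
    have e1 := mul_nonneg ht0.le hM0
    have e2 := mul_nonneg ht0.le hv
    have e3 := mul_nonneg ht0.le hK0
    refine ⟨ht.trans (min_le_left _ _), by linarith, fun i => ?_, by linarith⟩
    rw [abs_mul, abs_of_pos ht0]
    have := mul_le_mul_of_nonneg_left (hXM i) ht0.le
    linarith
  constructor
  · refine eq_zero_of_abs_le_mul (B := ∑ i, |X i| ^ 3) ht₁0 fun t ht0 ht => ?_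
    obtain ⟨h1, h2, h3, -⟩ := hsmall t ht0 ht
    have hsin : ∑ i, Real.sin (t * X i) = 0 := by
      have := congrArg Complex.im (hX t ht0 h1)
      rw [Complex.ofReal_im, Complex.im_sum] at this
      simpa only [Complex.exp_ofReal_mul_I_im] using this
    have hpt : ∀ i, |t * X i - Real.sin (t * X i)| ≤ |t * X i| ^ 3 := by
      intro i
      have hy := h3 i
      set y := t * X i
      have e1 := abs_le.1 (Real.sin_bound hy)
      have e2 : |y| ^ 5 ≤ |y| ^ 3 := pow_le_pow_of_le_one (abs_nonneg _) hy (by norm_num)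
      have e3 := abs_le.1 (abs_pow y 3).le
      have e4 : 0 ≤ |y| ^ 3 := by positivity
      rw [abs_le]
      constructor <;> linarith
    have h4 : t * |∑ i, X i| ≤ ∑ i, |t * X i| ^ 3 := by
      calc t * |∑ i, X i| = |∑ i, (t * X i - Real.sin (t * X i))| := by
            rw [Finset.sum_sub_distrib, hsin, sub_zero, ← Finset.mul_sum, abs_mul, abs_of_pos ht0]
        _ ≤ ∑ i, |t * X i - Real.sin (t * X i)| := Finset.abs_sum_le_sum_abs _ _
        _ ≤ _ := Finset.sum_le_sum fun i _ => hpt i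
    have h5 : ∑ i, |t * X i| ^ 3 = t ^ 3 * ∑ i, |X i| ^ 3 := by
      rw [Finset.mul_sum]
      refine Finset.sum_congr rfl fun i _ => ?_
      rw [abs_mul, abs_of_pos ht0, mul_pow]
    have hB : 0 ≤ ∑ i, |X i| ^ 3 := Finset.sum_nonneg fun i _ => by positivity
    rw [h5] at h4
    have h6 : t * |∑ i, X i| ≤ t * ((∑ i, |X i| ^ 3) * t) := by
      refine h4.trans ?_
      have : t ^ 3 ≤ t ^ 2 := pow_le_pow_of_le_one ht0.le h2 (by norm_num)
      nlinarith [mul_le_mul_of_nonneg_right this hB]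
    exact le_of_mul_le_mul_left h6 ht0
  · rw [← sub_eq_zero]
    refine eq_zero_of_abs_le_mul (B := 2 * (∑ i, |X i| ^ 4 + N * (K + (v + K) ^ 2))) ht₁0
      fun t ht0 ht => ?_
    obtain ⟨h1, h2, h3, h4⟩ := hsmall t ht0 ht
    set y := v * t ^ 2 / 2 + G t with hy
    have hcos : ∑ i, Real.cos (t * X i) = N * Real.exp (-y) := by
      have := congrArg Complex.re (hX t ht0 h1)
      rw [Complex.ofReal_re, Complex.re_sum] at this
      simp only [Complex.exp_ofReal_mul_I_re] at this
      rw [this, hy]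
      congr 2
      ring
    have hg0 := hG0 t ht0 h1
    have hgK := hGK t ht0 h1
    have ht2 : t ^ 4 ≤ t ^ 2 := pow_le_pow_of_le_one ht0.le h2 (by norm_num)
    have hy0 : 0 ≤ y := by positivity
    have hyle : y ≤ t ^ 2 * (v + K) := by
      have := mul_le_mul_of_nonneg_left ht2 hK0
      nlinarith [mul_nonneg hv (sq_nonneg t)]
    have hy1 : y ≤ 1 := by
      refine hyle.trans ?_
      rw [sq, mul_assoc]
      exact (mul_le_of_le_one_left (by positivity) h2).trans h4
    have hexp : |Real.exp (-y) - 1 + y| ≤ y ^ 2 := by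
      have := Real.abs_exp_sub_one_sub_id_le (x := -y) (by rw [abs_neg, abs_of_nonneg hy0]; exact hy1)
      rwa [sub_neg_eq_add, neg_sq] at this
    have hysq : y ^ 2 ≤ t ^ 4 * (v + K) ^ 2 := by
      calc y ^ 2 ≤ (t ^ 2 * (v + K)) ^ 2 := by gcongr
        _ = _ := by ring
    have hpt : ∀ i, |(t * X i) ^ 2 / 2 - (1 - Real.cos (t * X i))| ≤ t ^ 4 * |X i| ^ 4 := by
      intro i
      have e1 := Real.cos_bound (h3 i)
      rw [show (t * X i) ^ 2 / 2 - (1 - Real.cos (t * X i)) =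
        Real.cos (t * X i) - (1 - (t * X i) ^ 2 / 2) by ring]
      refine e1.trans ?_
      rw [abs_mul, abs_of_pos ht0, mul_pow]
      have : 0 ≤ t ^ 4 * |X i| ^ 4 := by positivity
      linarith
    have hsum : |∑ i, ((t * X i) ^ 2 / 2 - (1 - Real.cos (t * X i)))| ≤ t ^ 4 * ∑ i, |X i| ^ 4 := by
      rw [Finset.mul_sum]
      exact (Finset.abs_sum_le_sum_abs _ _).trans (Finset.sum_le_sum fun i _ => hpt i)
    have hid : t ^ 2 / 2 * (∑ i, X i ^ 2 - N * v) =
        (∑ i, ((t * X i) ^ 2 / 2 - (1 - Real.cos (t * X i)))) +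
          N * (G t - (Real.exp (-y) - 1 + y)) := by
      rw [Finset.sum_sub_distrib, Finset.sum_sub_distrib, hcos]
      simp_rw [mul_pow, mul_div_assoc, ← Finset.mul_sum, ← Finset.sum_div]
      simp only [Finset.sum_const, Finset.card_univ, nsmul_eq_mul, mul_one]
      rw [← hN, hy]
      ring
    have hrest : |N * (G t - (Real.exp (-y) - 1 + y))| ≤ N * (t ^ 4 * (K + (v + K) ^ 2)) := by
      rw [abs_mul, abs_of_nonneg hN0]
      refine mul_le_mul_of_nonneg_left ?_ hN0
      have := abs_le.1 hexp
      rw [abs_le]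
      have e : 0 ≤ t ^ 4 * K := by positivity
      constructor <;> nlinarith
    have htot : t ^ 2 / 2 * |∑ i, X i ^ 2 - N * v| ≤
        t ^ 4 * (∑ i, |X i| ^ 4 + N * (K + (v + K) ^ 2)) := by
      calc t ^ 2 / 2 * |∑ i, X i ^ 2 - N * v| = |t ^ 2 / 2 * (∑ i, X i ^ 2 - N * v)| := by
            rw [abs_mul, abs_of_nonneg (by positivity : 0 ≤ t ^ 2 / 2)]
        _ ≤ _ := by
            rw [hid]
            refine (abs_add_le _ _).trans ((add_le_add hsum hrest).trans (le_of_eq ?_))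
            ring
    have hB : 0 ≤ ∑ i, |X i| ^ 4 + N * (K + (v + K) ^ 2) :=
      add_nonneg (Finset.sum_nonneg fun i _ => by positivity) (by positivity)
    refine le_of_mul_le_mul_left (htot.trans ?_) (show 0 < t ^ 2 / 2 by positivity)
    have : t ^ 4 ≤ t ^ 3 := pow_le_pow_of_le_one ht0.le h2 (by norm_num)
    calc t ^ 4 * (∑ i, |X i| ^ 4 + N * (K + (v + K) ^ 2))
        ≤ t ^ 3 * (∑ i, |X i| ^ 4 + N * (K + (v + K) ^ 2)) := by gcongr
      _ = _ := by ring

end Moments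

/-! ### The characteristic function of the major index -/

/-- A finite geometric sum on the unit circle. -/
theorem geom_sum_mul_sinc (h : ℕ) (t : ℝ) :
    (∑ k ∈ Finset.range h, Complex.exp (t * Complex.I) ^ k) * (Real.sinc (t / 2) : ℝ) =
      h * Complex.exp (((h - 1) / 2 * t : ℝ) * Complex.I) * (Real.sinc (h * t / 2) : ℝ) := by
  rcases Nat.eq_zero_or_pos h with rfl | hh
  · simp
  by_cases ht : t = 0
  · simp [ht]
  have hh' : (h : ℝ) ≠ 0 := Nat.cast_ne_zero.2 hh.ne'
  have hhC : (h : ℂ) ≠ 0 := Nat.cast_ne_zero.2 hh.ne'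
  have htC : (t : ℂ) ≠ 0 := Complex.ofReal_ne_zero.2 ht
  rw [Real.sinc_of_ne_zero (by positivity), Real.sinc_of_ne_zero (by positivity)]
  set w : ℂ := Complex.exp ((t / 2 : ℝ) * Complex.I) with hw
  have hw0 : w ≠ 0 := Complex.exp_ne_zero _
  have hz : Complex.exp (t * Complex.I) = w ^ 2 := by
    rw [hw, ← Complex.exp_nat_mul]
    congr 1
    push_cast
    ring
  have hwh : Complex.exp ((h * t / 2 : ℝ) * Complex.I) = w ^ h := by
    rw [hw, ← Complex.exp_nat_mul]
    congr 1
    push_cast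
    ring
  have he : Complex.exp (((h - 1) / 2 * t : ℝ) * Complex.I) = w ^ h * w⁻¹ := by
    rw [← hwh, hw, ← Complex.exp_neg, ← Complex.exp_add]
    congr 1
    push_cast
    ring
  have hs1 : (Real.sin (t / 2) : ℂ) = (w⁻¹ - w) * Complex.I / 2 := by
    rw [Complex.ofReal_sin, Complex.sin, hw, ← Complex.exp_neg, neg_mul]
  have hs2 : (Real.sin (h * t / 2) : ℂ) = ((w ^ h)⁻¹ - w ^ h) * Complex.I / 2 := by
    rw [Complex.ofReal_sin, Complex.sin, ← hwh, ← Complex.exp_neg, neg_mul]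
  have hg := geom_sum_mul (w ^ 2) h
  rw [hz, he, Complex.ofReal_div (Real.sin (t / 2)),
    Complex.ofReal_div (Real.sin (h * t / 2)), hs1, hs2]
  set S := ∑ k ∈ Finset.range h, (w ^ 2) ^ k
  have hwhn : w ^ h ≠ 0 := pow_ne_zero _ hw0
  push_cast
  field_simp
  rw [← pow_mul, mul_comm 2 h, pow_mul] at hg
  linear_combination (-1 : ℂ) * hg

namespace StandardTableau

variable {μ : YoungDiagram}

theorem card_mul_prod_hookLen (hμ : 0 < μ.card) :
    Fintype.card (StandardTableau μ) * ∏ c ∈ μ.cells, μ.hookLen c =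
      ∏ k ∈ Finset.range μ.card, (k + 1) := by
  obtain ⟨a, b, h⟩ := exists_sum_pow_maj_mul_hook μ hμ
  have := h 1
  simp only [one_pow, one_mul, Finset.sum_const, Finset.card_univ, Finset.card_range,
    nsmul_eq_mul, mul_one] at this
  exact_mod_cast this

theorem card_pos (hμ : 0 < μ.card) : 0 < Fintype.card (StandardTableau μ) := by
  refine Nat.pos_of_ne_zero fun h0 => ?_
  have h := card_mul_prod_hookLen hμ
  rw [h0, zero_mul] at h
  exact (Finset.prod_pos fun k _ => Nat.succ_pos k).ne h

/-- The characteristic function of the major index, centered at its mean, is a quotient of products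
of values of `sinc`. -/
theorem exists_sum_exp_mul_prod_sinc (hμ : 0 < μ.card) :
    ∃ m : ℝ, ∀ t : ℝ,
      (∑ T : StandardTableau μ, Complex.exp ((t * (T.maj - m) : ℝ) * Complex.I)) *
          ((∏ c ∈ μ.cells, Real.sinc (μ.hookLen c * t / 2) : ℝ) : ℂ) =
        ((Fintype.card (StandardTableau μ) *
          ∏ k ∈ Finset.range μ.card, Real.sinc ((k + 1) * t / 2) : ℝ) : ℂ) := by
  obtain ⟨a, b, h⟩ := exists_sum_pow_maj_mul_hook μ hμ
  have hone := card_mul_prod_hookLen hμ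
  set α : ℝ := ∑ c ∈ μ.cells, ((μ.hookLen c : ℝ) - 1) / 2 with hα
  set β : ℝ := ∑ k ∈ Finset.range μ.card, (((k + 1 : ℕ) : ℝ) - 1) / 2 with hβ
  refine ⟨b + β - a - α, fun t => ?_⟩
  set z := Complex.exp (t * Complex.I) with hz
  have hzpow : ∀ k : ℕ, z ^ k = Complex.exp ((k * t : ℝ) * Complex.I) := by
    intro k
    rw [hz, ← Complex.exp_nat_mul]
    congr 1
    push_cast
    ring
  have hcells : (Real.sinc (t / 2) : ℂ) ^ μ.card *
      ∏ c ∈ μ.cells, ∑ i ∈ Finset.range (μ.hookLen c), z ^ i =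
      (∏ c ∈ μ.cells, (μ.hookLen c : ℂ)) * Complex.exp ((α * t : ℝ) * Complex.I) *
        ∏ c ∈ μ.cells, (Real.sinc (μ.hookLen c * t / 2) : ℂ) := by
    rw [YoungDiagram.card, ← Finset.prod_const, ← Finset.prod_mul_distrib, hα, Finset.sum_mul,
      Complex.ofReal_sum, Finset.sum_mul, Complex.exp_sum, ← Finset.prod_mul_distrib,
      ← Finset.prod_mul_distrib]
    exact Finset.prod_congr rfl fun c _ => by rw [mul_comm, geom_sum_mul_sinc]
  have hrange : (Real.sinc (t / 2) : ℂ) ^ μ.card *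
      ∏ k ∈ Finset.range μ.card, ∑ i ∈ Finset.range (k + 1), z ^ i =
      (∏ k ∈ Finset.range μ.card, ((k + 1 : ℕ) : ℂ)) * Complex.exp ((β * t : ℝ) * Complex.I) *
        ∏ k ∈ Finset.range μ.card, (Real.sinc (((k + 1 : ℕ) : ℝ) * t / 2) : ℂ) := by
    have hc := Finset.prod_const (s := Finset.range μ.card) (Real.sinc (t / 2) : ℂ)
    rw [Finset.card_range] at hc
    rw [← hc, ← Finset.prod_mul_distrib, hβ, Finset.sum_mul,
      Complex.ofReal_sum, Finset.sum_mul, Complex.exp_sum, ← Finset.prod_mul_distrib,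
      ← Finset.prod_mul_distrib]
    exact Finset.prod_congr rfl fun c _ => by rw [mul_comm, geom_sum_mul_sinc]
  have hone' : (Fintype.card (StandardTableau μ) : ℂ) * ∏ c ∈ μ.cells, (μ.hookLen c : ℂ) =
      ∏ k ∈ Finset.range μ.card, ((k + 1 : ℕ) : ℂ) := by
    exact_mod_cast hone
  have hH : ∏ c ∈ μ.cells, (μ.hookLen c : ℂ) ≠ 0 :=
    Finset.prod_ne_zero_iff.2 fun c _ => Nat.cast_ne_zero.2 (by rw [YoungDiagram.hookLen]; omega)
  have hkey := congrArg (fun x => (Real.sinc (t / 2) : ℂ) ^ μ.card * x) (h z)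
  rw [mul_left_comm, hcells, mul_left_comm _ (z ^ b), hrange, ← hone', hzpow a, hzpow b] at hkey
  have hsum : ∑ T : StandardTableau μ, Complex.exp ((t * (T.maj - (b + β - a - α)) : ℝ) * Complex.I) =
      Complex.exp ((t * (a + α - b - β) : ℝ) * Complex.I) * ∑ T : StandardTableau μ, z ^ T.maj := by
    rw [Finset.mul_sum]
    refine Finset.sum_congr rfl fun T _ => ?_
    rw [hzpow, ← Complex.exp_add]
    congr 1
    push_cast
    ring
  rw [hsum]
  have he : Complex.exp ((t * (a + α - b - β) : ℝ) * Complex.I) *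
      (Complex.exp ((b * t : ℝ) * Complex.I) * Complex.exp ((β * t : ℝ) * Complex.I)) =
      Complex.exp ((a * t : ℝ) * Complex.I) * Complex.exp ((α * t : ℝ) * Complex.I) := by
    rw [← Complex.exp_add, ← Complex.exp_add, ← Complex.exp_add]
    congr 1
    push_cast
    ring
  have hb0 : Complex.exp ((b * t : ℝ) * Complex.I) * Complex.exp ((β * t : ℝ) * Complex.I) ≠ 0 :=
    mul_ne_zero (Complex.exp_ne_zero _) (Complex.exp_ne_zero _)
  refine mul_left_cancel₀ hb0 (mul_left_cancel₀ hH ?_)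
  push_cast at hkey ⊢
  push_cast at he
  linear_combination hkey + (∏ c ∈ μ.cells, (μ.hookLen c : ℂ)) *
    (∑ T : StandardTableau μ, z ^ T.maj) *
    (∏ c ∈ μ.cells, (Real.sinc (μ.hookLen c * t / 2) : ℂ)) * he

/-- The variance of the major index in terms of the hook lengths, see `majVar_eq_and_sum_exp_eq`. -/
noncomputable def hookVar (μ : YoungDiagram) : ℝ :=
  (∑ k ∈ Finset.range μ.card, ((k : ℝ) + 1) ^ 2 - ∑ c ∈ μ.cells, (μ.hookLen c : ℝ) ^ 2) / 12

/-- The part of the logarithm of the characteristic function of the centered major index beyond the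
quadratic term, with the opposite sign. -/
noncomputable def hookTail (μ : YoungDiagram) (t : ℝ) : ℝ :=
  ∑ k ∈ Finset.range μ.card, logSincTail ((k + 1) * t / 2) -
    ∑ c ∈ μ.cells, logSincTail (μ.hookLen c * t / 2)

theorem mul_div_two_le {k n : ℕ} (hk : k ≤ n) {t : ℝ} (ht0 : 0 < t) (ht : t * n ≤ 3) :
    0 ≤ k * t / 2 ∧ k * t / 2 ≤ 3 / 2 := by
  have h1 : (k : ℝ) ≤ n := by exact_mod_cast hk
  have := mul_le_mul_of_nonneg_left h1 ht0.le
  exact ⟨by positivity, by linarith⟩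

theorem hookTail_nonneg {t : ℝ} (ht0 : 0 < t) (ht : t * μ.card ≤ 3) : 0 ≤ hookTail μ t := by
  have h := YoungDiagram.sum_hookLen_le (μ := μ) (f := fun k : ℕ => logSincTail (k * t / 2))
    (by simp [logSincTail_zero]) fun m hm => by
      refine monotoneOn_logSincTail (mul_div_two_le hm.le ht0 ht)
        (mul_div_two_le (Nat.succ_le_of_lt hm) ht0 ht) ?_
      push_cast
      gcongr
      linarith
  rw [hookTail, sub_nonneg]
  simpa using h

theorem hookTail_le {t : ℝ} (ht0 : 0 < t) (ht : t * μ.card ≤ 3) :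
    hookTail μ t ≤ (μ.card : ℝ) ^ 5 / 288 * t ^ 4 := by
  have h1 : 0 ≤ ∑ c ∈ μ.cells, logSincTail (μ.hookLen c * t / 2) := by
    refine Finset.sum_nonneg fun c hc => ?_
    have h2 := mul_div_two_le (YoungDiagram.hookLen_le_card hc) ht0 ht
    have h3 := monotoneOn_logSincTail ⟨le_rfl, by norm_num⟩ h2 h2.1
    rwa [logSincTail_zero] at h3
  have h4 : ∀ k ∈ Finset.range μ.card, logSincTail ((k + 1) * t / 2) ≤
      (μ.card : ℝ) ^ 4 / 288 * t ^ 4 := by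
    intro k hk
    have hk' := Finset.mem_range.1 hk
    have h2 := mul_div_two_le (Nat.succ_le_of_lt hk') ht0 ht
    push_cast at h2
    refine (logSincTail_le h2.1 h2.2).trans ?_
    have h5 : ((k : ℝ) + 1) * t / 2 ≤ μ.card * t / 2 := by
      gcongr
      exact_mod_cast hk'
    calc ((k + 1) * t / 2) ^ 4 / 18 ≤ (μ.card * t / 2) ^ 4 / 18 := by
          have := h2.1
          gcongr
      _ = _ := by ring
  have h5 := Finset.sum_le_sum h4
  rw [Finset.sum_const, Finset.card_range, nsmul_eq_mul] at h5
  rw [hookTail]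
  calc _ ≤ ∑ k ∈ Finset.range μ.card, logSincTail ((k + 1) * t / 2) := by linarith
    _ ≤ _ := h5
    _ = _ := by ring

theorem exists_sum_exp_eq (hμ : 0 < μ.card) :
    ∃ m : ℝ, ∀ t : ℝ, 0 < t → t * μ.card ≤ 3 →
      ∑ T : StandardTableau μ, Complex.exp ((t * (T.maj - m) : ℝ) * Complex.I) =
        ((Fintype.card (StandardTableau μ) *
          Real.exp (-(hookVar μ * t ^ 2 / 2) - hookTail μ t) : ℝ) : ℂ) := by
  obtain ⟨m, hm⟩ := exists_sum_exp_mul_prod_sinc hμ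
  refine ⟨m, fun t ht0 ht => ?_⟩
  have hpi := Real.pi_gt_three
  have h1 := hm t
  have h2 : ∏ c ∈ μ.cells, Real.sinc (μ.hookLen c * t / 2) =
      Real.exp (∑ c ∈ μ.cells,
        (-((μ.hookLen c * t / 2) ^ 2 / 6) - logSincTail (μ.hookLen c * t / 2))) := by
    rw [Real.exp_sum]
    refine Finset.prod_congr rfl fun c hc => ?_
    have := mul_div_two_le (YoungDiagram.hookLen_le_card hc) ht0 ht
    exact sinc_eq_exp this.1 (by linarith [this.2])
  have h3 : ∏ k ∈ Finset.range μ.card, Real.sinc ((k + 1) * t / 2) =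
      Real.exp (∑ k ∈ Finset.range μ.card,
        (-((((k : ℝ) + 1) * t / 2) ^ 2 / 6) - logSincTail ((k + 1) * t / 2))) := by
    rw [Real.exp_sum]
    refine Finset.prod_congr rfl fun k hk => ?_
    have := mul_div_two_le (Nat.succ_le_of_lt (Finset.mem_range.1 hk)) ht0 ht
    push_cast at this
    exact sinc_eq_exp this.1 (by linarith [this.2])
  have h4 : (∑ k ∈ Finset.range μ.card,
        (-((((k : ℝ) + 1) * t / 2) ^ 2 / 6) - logSincTail ((k + 1) * t / 2))) =
      (-(hookVar μ * t ^ 2 / 2) - hookTail μ t) + ∑ c ∈ μ.cells,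
        (-((μ.hookLen c * t / 2) ^ 2 / 6) - logSincTail (μ.hookLen c * t / 2)) := by
    have e : ∀ x : ℝ, -((x * t / 2) ^ 2 / 6) = -(t ^ 2 / 24) * x ^ 2 := fun x => by ring
    simp_rw [Finset.sum_sub_distrib, e, ← Finset.mul_sum]
    rw [hookVar, hookTail]
    ring
  rw [h2, h3, h4, Real.exp_add, ← mul_assoc, Complex.ofReal_mul _ (Real.exp (Finset.sum _ _))] at h1
  exact mul_right_cancel₀ (Complex.ofReal_ne_zero.2 (Real.exp_ne_zero _)) h1

theorem hookVar_pos (hμ : 0 < μ.card) (h : μ.rowLen 0 + μ.colLen 0 ≤ μ.card) : 0 < hookVar μ := by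
  have := YoungDiagram.sum_hookLen_sq_lt hμ h
  rw [hookVar]
  linarith

theorem le_hookVar (h1 : 2 * μ.rowLen 0 ≤ μ.card) (h2 : 2 * μ.colLen 0 ≤ μ.card)
    (h : 900 ≤ μ.card) : (μ.card : ℝ) ^ 3 / 80 ≤ hookVar μ := by
  have h3 := YoungDiagram.sum_hookLen_sq_le h1 h2
  have h4 : ∀ n : ℕ, (n : ℝ) ^ 3 / 3 ≤ ∑ k ∈ Finset.range n, ((k : ℝ) + 1) ^ 2 := by
    intro n
    induction n with
    | zero => simp
    | succ n ih =>
      rw [Finset.sum_range_succ]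
      push_cast
      nlinarith [(Nat.cast_nonneg n : (0 : ℝ) ≤ n)]
  have h5 := h4 μ.card
  have h6 : (900 : ℝ) ≤ μ.card := by exact_mod_cast h
  rw [hookVar]
  set n : ℝ := (μ.card : ℝ)
  nlinarith [mul_nonneg (sq_nonneg n) (sub_nonneg.2 h6), mul_nonneg (by linarith : 0 ≤ n) (sub_nonneg.2 h6)]

end StandardTableau

/-! ### The Kolmogorov distance to the Gaussian law -/

namespace StandardTableau

variable {μ : YoungDiagram}

instance : MeasurableSingletonClass (StandardTableau μ) := ⟨fun _ => trivial⟩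

theorem isProbabilityMeasure_uniformTableau (hμ : 0 < μ.card) :
    IsProbabilityMeasure (uniformTableau μ) :=
  have : Nonempty (StandardTableau μ) := Fintype.card_pos_iff.1 (card_pos hμ)
  isProbabilityMeasure_uniformOn Set.finite_univ Set.univ_nonempty

theorem integral_uniformTableau {E : Type*} [NormedAddCommGroup E] [NormedSpace ℝ E]
    [CompleteSpace E] (hμ : 0 < μ.card) (f : StandardTableau μ → E) :
    ∫ T, f T ∂(uniformTableau μ) = (Fintype.card (StandardTableau μ) : ℝ)⁻¹ • ∑ T, f T := by
  have := isProbabilityMeasure_uniformTableau hμ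
  rw [integral_fintype Integrable.of_finite, Finset.smul_sum]
  refine Finset.sum_congr rfl fun T _ => ?_
  congr 1
  rw [Measure.real, uniformTableau, uniformOn_univ]
  simp

theorem majVar_eq_and_sum_exp_eq (hμ : 0 < μ.card) (h : μ.rowLen 0 + μ.colLen 0 ≤ μ.card) :
    majVar μ = hookVar μ ∧ ∀ t : ℝ, 0 < t → t * μ.card ≤ 3 →
      ∑ T : StandardTableau μ, Complex.exp ((t * (T.maj - majMean μ) : ℝ) * Complex.I) =
        ((Fintype.card (StandardTableau μ) *
          Real.exp (-(hookVar μ * t ^ 2 / 2) - hookTail μ t) : ℝ) : ℂ) := by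
  obtain ⟨m, hm⟩ := exists_sum_exp_eq hμ
  have hc : (0 : ℝ) < μ.card := by exact_mod_cast hμ
  have hN : (0 : ℝ) < Fintype.card (StandardTableau μ) := by exact_mod_cast card_pos hμ
  have hle : ∀ t : ℝ, t ≤ 3 / μ.card → t * μ.card ≤ 3 := fun t ht => (le_div_iff₀ hc).1 ht
  have hmom := sum_eq_zero_and_sum_sq_eq (fun T : StandardTableau μ => (T.maj : ℝ) - m)
    (v := hookVar μ) (K := (μ.card : ℝ) ^ 5 / 288) (t₀ := 3 / μ.card) (G := hookTail μ)
    (by positivity) (hookVar_pos hμ h).le (fun t ht0 ht => hookTail_nonneg ht0 (hle t ht))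
    (fun t ht0 ht => hookTail_le ht0 (hle t ht)) (fun t ht0 ht => hm t ht0 (hle t ht))
  have hmean : majMean μ = m := by
    have h1 := hmom.1
    rw [Finset.sum_sub_distrib, Finset.sum_const, Finset.card_univ, nsmul_eq_mul] at h1
    rw [majMean, integral_uniformTableau hμ, smul_eq_mul, sub_eq_zero.1 h1]
    field_simp
  refine ⟨?_, fun t ht0 ht => by rw [hmean]; exact hm t ht0 ht⟩
  have hmean' : ∫ T, (T.maj : ℝ) ∂(uniformTableau μ) = m := hmean
  rw [majVar, variance_eq_integral (measurable_from_top.aemeasurable), hmean',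
    integral_uniformTableau hμ, hmom.2, smul_eq_mul]
  field_simp

/-- The restriction on `x` keeps all sinc factors positive, so that their logarithms make sense. -/
theorem charFun_standardizedMajLaw (hμ : 0 < μ.card) (h : μ.rowLen 0 + μ.colLen 0 ≤ μ.card)
    {x : ℝ} (hx0 : 0 < x) (hx : x * μ.card ≤ 3 * √(hookVar μ)) :
    charFun (standardizedMajLaw μ) x =
      (Real.exp (-(x ^ 2 / 2) - hookTail μ (x / √(hookVar μ))) : ℂ) := by
  have hN : (Fintype.card (StandardTableau μ) : ℂ) ≠ 0 := by exact_mod_cast (card_pos hμ).ne'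
  have hv := hookVar_pos hμ h
  have hs : 0 < √(hookVar μ) := Real.sqrt_pos.2 hv
  obtain ⟨hvar, hexp⟩ := majVar_eq_and_sum_exp_eq hμ h
  have hsum := hexp (x / √(hookVar μ)) (by positivity) (by
    rw [div_mul_eq_mul_div, div_le_iff₀ hs]
    exact hx)
  rw [charFun_apply_real, standardizedMajLaw, hvar,
    integral_map measurable_from_top.aemeasurable (by fun_prop), integral_uniformTableau hμ]
  have : ∀ T : StandardTableau μ,
      Complex.exp (x * ((((T.maj : ℝ) - majMean μ) / √(hookVar μ) : ℝ) : ℂ) * Complex.I) =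
        Complex.exp ((x / √(hookVar μ) * (T.maj - majMean μ) : ℝ) * Complex.I) := by
    intro T
    congr 1
    push_cast
    ring
  simp_rw [this]
  rw [hsum, div_pow, Real.sq_sqrt hv.le, mul_div_cancel₀ _ hv.ne', Complex.ofReal_mul,
    Complex.real_smul]
  push_cast
  field_simp

end StandardTableau

theorem gaussianReal_real_Iic_le (x y : ℝ) (hxy : x ≤ y) :
    (gaussianReal 0 1).real (Set.Iic y) ≤ (gaussianReal 0 1).real (Set.Iic x) + 2 / 5 * (y - x) := by
  have h1 : (gaussianReal 0 1).real (Set.Ioc x y) ≤ 2 / 5 * (y - x) := by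
    rw [Measure.real, gaussianReal_apply_eq_integral _ one_ne_zero, ENNReal.toReal_ofReal
      (integral_nonneg fun z => gaussianPDFReal_nonneg _ _ _)]
    have hb : ∀ z, gaussianPDFReal 0 1 z ≤ 2 / 5 := by
      intro z
      have h2 : (√(2 * Real.pi * (1 : NNReal)))⁻¹ ≤ 2 / 5 := by
        rw [inv_le_comm₀ (by have := Real.pi_pos; positivity) (by norm_num)]
        refine Real.le_sqrt_of_sq_le ?_
        have := Real.pi_gt_d2
        norm_num
        linarith
      have h3 : Real.exp (-(z - 0) ^ 2 / (2 * (1 : NNReal))) ≤ 1 := by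
        rw [Real.exp_le_one_iff]
        exact div_nonpos_of_nonpos_of_nonneg (neg_nonpos.2 (sq_nonneg _)) (by positivity)
      rw [gaussianPDFReal]
      calc _ ≤ (√(2 * Real.pi * (1 : NNReal)))⁻¹ * 1 := by gcongr
        _ ≤ _ := by linarith
    calc ∫ z in Set.Ioc x y, gaussianPDFReal 0 1 z ≤ ∫ _ in Set.Ioc x y, (2 / 5 : ℝ) :=
          setIntegral_mono (integrable_gaussianPDFReal 0 1).integrableOn
            (integrableOn_const (by simp)) hb
      _ = _ := by
          rw [setIntegral_const, Real.volume_real_Ioc_of_le hxy, smul_eq_mul, mul_comm]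
  have h2 : Set.Iic y = Set.Iic x ∪ Set.Ioc x y := (Set.Iic_union_Ioc_eq_Iic hxy).symm
  rw [h2]
  exact (measureReal_union_le _ _).trans (by linarith)

theorem integral_pow_three_mul_exp_le (B T : ℝ) (hB : 0 ≤ B) :
    ∫ t in (0 : ℝ)..1, B * T ^ 4 * t ^ 3 * Real.exp (-((T * t) ^ 2 / 2)) ≤ 2 * B := by
  have hderiv : ∀ t ∈ Set.uIcc (0 : ℝ) 1, HasDerivAt
      (fun t => -(B * ((T * t) ^ 2 + 2) * Real.exp (-((T * t) ^ 2 / 2))))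
      (B * T ^ 4 * t ^ 3 * Real.exp (-((T * t) ^ 2 / 2))) t := by
    intro t _
    have h1 : HasDerivAt (fun t : ℝ => (T * t) ^ 2) (2 * T ^ 2 * t) t := by
      refine (((hasDerivAt_id t).const_mul T).pow 2).congr_deriv ?_
      simp
      ring
    refine (((h1.add_const 2).const_mul B).mul ((h1.div_const 2).neg.exp)).neg.congr_deriv ?_
    simp only [Pi.neg_apply]
    ring
  rw [intervalIntegral.integral_eq_sub_of_hasDerivAt hderiv
    (Continuous.intervalIntegrable (by fun_prop) _ _)]
  have : 0 ≤ B * ((T * 1) ^ 2 + 2) * Real.exp (-((T * 1) ^ 2 / 2)) := by positivity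
  simp only [mul_zero, ne_eq, OfNat.ofNat_ne_zero, not_false_eq_true, zero_pow, zero_div, neg_zero,
    Real.exp_zero]
  linarith

open StandardTableau in
theorem kolmogorovDist_standardizedMajLaw_le {μ : YoungDiagram} (h1 : 2 * μ.rowLen 0 ≤ μ.card)
    (h2 : 2 * μ.colLen 0 ≤ μ.card) (hn : 900 ≤ μ.card) :
    kolmogorovDist (standardizedMajLaw μ) (gaussianReal 0 1) ≤ 30 / √(μ.card : ℝ) := by
  have hμ : 0 < μ.card := by omega
  have hrc : μ.rowLen 0 + μ.colLen 0 ≤ μ.card := by omega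
  have hprob := isProbabilityMeasure_uniformTableau hμ
  have hmeas : Measurable fun T : StandardTableau μ =>
    ((T.maj : ℝ) - majMean μ) / √(majVar μ) := measurable_from_top
  have hP : IsProbabilityMeasure (standardizedMajLaw μ) :=
    Measure.isProbabilityMeasure_map hmeas.aemeasurable
  have hPi : Integrable (fun X => X) (standardizedMajLaw μ) := by
    rw [standardizedMajLaw, integrable_map_measure (by fun_prop) hmeas.aemeasurable]
    exact Integrable.of_finite
  have hQi : Integrable (fun X => X) (gaussianReal 0 1) :=
    (memLp_id_gaussianReal 1).integrable le_rfl
  have hv := hookVar_pos hμ hrc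
  have hvle := le_hookVar h1 h2 hn
  set n : ℝ := (μ.card : ℝ) with hndef
  have hn900 : (900 : ℝ) ≤ n := by rw [hndef]; exact_mod_cast hn
  have hn0 : 0 < n := by linarith
  set σ := √(hookVar μ) with hσ
  have hσ0 : 0 < σ := Real.sqrt_pos.2 hv
  have hσsq : σ ^ 2 = hookVar μ := Real.sq_sqrt hv.le
  set T := 3 * σ / n with hT
  have hT0 : 0 < T := by positivity
  set B := n ^ 5 / (288 * σ ^ 4) with hB
  have hB0 : 0 ≤ B := by positivity
  have hφ : ∀ t ∈ Set.Ioc (0 : ℝ) 1,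
      ‖charFun (standardizedMajLaw μ) (T * t) - charFun (gaussianReal 0 1) (T * t)‖ ≤
        t * (B * T ^ 4 * t ^ 3 * Real.exp (-((T * t) ^ 2 / 2))) := by
    intro t ht
    have ht0 : 0 < t := ht.1
    have hx0 : 0 < T * t := by positivity
    have hx : T * t * n ≤ 3 * σ := by
      have : T * t * n = 3 * σ * t := by rw [hT]; field_simp
      rw [this]
      exact mul_le_of_le_one_right (by positivity) ht.2
    rw [charFun_standardizedMajLaw hμ hrc hx0 hx, charFun_gaussianReal]
    have hgauss : Complex.exp (((T * t : ℝ) : ℂ) * ((0 : ℝ) : ℂ) * Complex.I -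
        ((1 : NNReal) : ℂ) * ((T * t : ℝ) : ℂ) ^ 2 / 2) =
        ((Real.exp (-((T * t) ^ 2 / 2)) : ℝ) : ℂ) := by
      push_cast
      congr 1
      ring
    have hx' : T * t / σ * μ.card ≤ 3 := by
      rw [div_mul_eq_mul_div, div_le_iff₀ hσ0]
      exact hx
    have hg0 := hookTail_nonneg (μ := μ) (div_pos hx0 hσ0) hx'
    have hgle := hookTail_le (μ := μ) (div_pos hx0 hσ0) hx'
    rw [← hσ, hgauss, ← Complex.ofReal_sub, Complex.norm_real, Real.norm_eq_abs,
      abs_sub_comm, sub_eq_add_neg (-((T * t) ^ 2 / 2)), Real.exp_add]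
    have he1 := Real.add_one_le_exp (-hookTail μ (T * t / σ))
    have he2 : Real.exp (-hookTail μ (T * t / σ)) ≤ 1 := Real.exp_le_one_iff.2 (by linarith)
    rw [show Real.exp (-((T * t) ^ 2 / 2)) -
        Real.exp (-((T * t) ^ 2 / 2)) * Real.exp (-hookTail μ (T * t / σ)) =
        (1 - Real.exp (-hookTail μ (T * t / σ))) * Real.exp (-((T * t) ^ 2 / 2)) by ring,
      abs_mul, abs_of_nonneg (by linarith), abs_of_pos (Real.exp_pos _)]
    calc (1 - Real.exp (-hookTail μ (T * t / σ))) * Real.exp (-((T * t) ^ 2 / 2))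
        ≤ (n ^ 5 / 288 * (T * t / σ) ^ 4) * Real.exp (-((T * t) ^ 2 / 2)) := by
          gcongr
          linarith
      _ = _ := by
          rw [hB]
          field_simp
  have hsqrt : 0 < √n := Real.sqrt_pos.2 hn0
  have hsqrt_sq : √n ^ 2 = n := Real.sq_sqrt hn0.le
  have hsqrt30 : 30 ≤ √n := Real.le_sqrt_of_sq_le (by norm_num; exact hn900)
  have hpi := Real.pi_gt_d2
  -- The two error terms of the smoothing inequality are at most `2 / √n` and `28 / √n`.
  have hBle : B ≤ 24 / n := by
    rw [hB, div_le_div_iff₀ (by positivity) hn0]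
    have h3 : (n ^ 3 / 80) ^ 2 ≤ (σ ^ 2) ^ 2 := by
      rw [hσsq]
      gcongr
    nlinarith [pow_pos hn0 6]
  have hterm1 : 2 / Real.pi * (2 * B) ≤ 2 / √n := by
    have h3 : 2 / Real.pi ≤ 2 / 3 := by gcongr; linarith
    have h4 : 24 / n ≤ 24 / (30 * √n) := by
      gcongr
      calc 30 * √n ≤ √n * √n := by gcongr
        _ = n := by rw [← sq, hsqrt_sq]
    calc 2 / Real.pi * (2 * B) ≤ 2 / 3 * (2 * (24 / (30 * √n))) := by
          gcongr
          exact hBle.trans h4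
      _ ≤ 2 / √n := by
          rw [show 2 / 3 * (2 * (24 / (30 * √n))) = (16 / 15) / √n by field_simp; norm_num]
          gcongr
          norm_num
  have hterm2 : 64 * (2 / 5) / (Real.pi * T) ≤ 28 / √n := by
    have hσle : n * √n / 9 ≤ σ := by
      rw [hσ]
      refine Real.le_sqrt_of_sq_le ?_
      calc (n * √n / 9) ^ 2 = n ^ 2 * √n ^ 2 / 81 := by ring
        _ = n ^ 3 / 81 := by rw [hsqrt_sq]; ring
        _ ≤ n ^ 3 / 80 := by gcongr; norm_num
        _ ≤ _ := hvle
    have hTle : √n / 3 ≤ T := by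
      rw [hT, le_div_iff₀ hn0]
      linarith
    rw [div_le_div_iff₀ (by positivity) hsqrt]
    have : 3 * (√n / 3) ≤ Real.pi * T := by gcongr; linarith
    linarith
  refine ciSup_le fun s => ?_
  refine (abs_measureReal_Iic_sub_le _ _ hPi hQi gaussianReal_real_Iic_le hT0
    (Continuous.intervalIntegrable (by fun_prop) _ _) hφ s).trans ?_
  have hint := integral_pow_three_mul_exp_le B T hB0
  calc _ ≤ 2 / Real.pi * (2 * B) + 64 * (2 / 5) / (Real.pi * T) := by gcongr
    _ ≤ 2 / √n + 28 / √n := add_le_add hterm1 hterm2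
    _ = _ := by ring

theorem kolmogorovDist_le_one (P Q : Measure ℝ) [IsProbabilityMeasure P] [IsProbabilityMeasure Q] :
    kolmogorovDist P Q ≤ 1 := by
  refine ciSup_le fun x => ?_
  rw [abs_sub_le_iff]
  have h1 := measureReal_nonneg (μ := P) (s := Set.Iic x)
  have h2 := measureReal_nonneg (μ := Q) (s := Set.Iic x)
  have h3 := measureReal_le_one (μ := P) (s := Set.Iic x)
  have h4 := measureReal_le_one (μ := Q) (s := Set.Iic x)
  constructor <;> linarith

theorem theoremC :
    ∃ C : ℝ, 0 < C ∧ C ≤ 30 ∧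
      ∀ (lam : ℕ → YoungDiagram), IsGrowing lam →
      ∀ n₀ : ℕ, 4 ≤ n₀ →
        (∀ n : ℕ, n₀ ≤ n →
          max (((lam n).rowLen 0 : ℝ) / (n : ℝ)) (((lam n).colLen 0 : ℝ) / (n : ℝ)) ≤ 1 / 2) →
        ∀ n : ℕ, n₀ ≤ n →
          0 < majVar (lam n) ∧
          kolmogorovDist (standardizedMajLaw (lam n)) (gaussianReal 0 1) ≤ C / √(n : ℝ) := by
  refine ⟨30, by norm_num, le_rfl, fun lam hlam n₀ hn₀ hmax n hn => ?_⟩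
  have hcard : (lam n).card = n := hlam n (by omega)
  have hnpos : (0 : ℝ) < n := by exact_mod_cast (by omega : 0 < n)
  obtain ⟨hr, hc⟩ := max_le_iff.1 (hmax n hn)
  rw [div_le_iff₀ hnpos] at hr hc
  have h1 : 2 * (lam n).rowLen 0 ≤ (lam n).card := by
    rw [hcard]
    have : (2 * (lam n).rowLen 0 : ℝ) ≤ n := by linarith
    exact_mod_cast this
  have h2 : 2 * (lam n).colLen 0 ≤ (lam n).card := by
    rw [hcard]
    have : (2 * (lam n).colLen 0 : ℝ) ≤ n := by linarith
    exact_mod_cast this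
  have hμ : 0 < (lam n).card := by omega
  refine ⟨?_, ?_⟩
  · rw [(StandardTableau.majVar_eq_and_sum_exp_eq hμ (by omega)).1]
    exact StandardTableau.hookVar_pos hμ (by omega)
  -- Below `900` the bound is at least `1`, and no Kolmogorov distance exceeds `1`.
  · by_cases h900 : 900 ≤ (lam n).card
    · have := kolmogorovDist_standardizedMajLaw_le h1 h2 h900
      rwa [hcard] at this
    · have hprob := StandardTableau.isProbabilityMeasure_uniformTableau hμ
      have hP : IsProbabilityMeasure (standardizedMajLaw (lam n)) :=
        Measure.isProbabilityMeasure_map measurable_from_top.aemeasurable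
      refine (kolmogorovDist_le_one _ _).trans ?_
      rw [le_div_iff₀ (Real.sqrt_pos.2 hnpos), one_mul]
      refine Real.sqrt_le_iff.2 ⟨by norm_num, ?_⟩
      have : (n : ℝ) ≤ 900 := by exact_mod_cast (by omega : n ≤ 900)
      linarith
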